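/- Let $G=(V,E,w_G)$ be a directed graph with $n=|V|\ge 1$ and integral edge weights $w_G\ge -W$, where $W\ge 1$ is an integer. Below, $\log x$ and $\log\log x$ are read as at least $1$. Paths may be non-simple and include the empty path at each vertex; a *shortest path to $v$* is one of minimum weight among all paths that end at $v$, starting anywhere. For a graph $H$, $H_{\ge 0}$ is $H$ with negative weights replaced by $0$; for $\phi:V(H)\to\mathbb R$, $H_\phi$ has the weights $w_H(uv)+\phi(u)-\phi(v)$; and $n_H=|V(H)|$, $m_H=|E(H)|$. **The algorithm.** Let $G'$ be $G$ with all weights increased by $W/2$, and $d_0=nW/2$. *Decomposition tree.* The root is $(G',d_0)$. At a non-leaf node $(H,d)$, a random set $S=S_{(H,d)}=\textsc{Decompose}(H,d)$ of edges is drawn. The children are the strongly connected components $C$ of $H\setminus S$, with parameter $d_C=d$ if $|V(C)|\le\frac34 n_H$ and $d_C=d/2$ otherwise; a child is a non-leaf iff $d_C>W/2$ (the root always is one). Different calls use independent randomness. $\textsc{Decompose}(H,d)$, with a constant $c>0$, uses distances in $H_{\ge0}$: a uniform sample of $\lceil c\log n\rceil$ vertices (with replacement) is drawn, and a vertex is *out-light*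 (*in-light*) if its out-ball (in-ball) of radius $d/4$ contains at most $5/8$ of the sample. Then, for each out-light vertex $v$ that still remains, the out-ball of $v$ of radius $j/2$ in the remaining graph is removed, where $j\in\{0,1,2,\dots\}$ is freshly drawn from the geometric distribution with success probability $\min(1,c\log n/d)$, and the edges leaving the ball are put into $S$; after that, the same is done with the remaining in-light vertices, their in-balls, and the edges entering these. *Potentials.* The tree is processed bottom-up from $\phi=0$. If some leaf contains a negative edge, the algorithm stops. At a non-leaf node $(H,d)$, after all its descendants have been processed, $\phi$ is first lowered component by component, in a topological order of the components of $H\setminus S$, so that all edges of $(H\setminus S)_\phi$ become nonnegative; then $\textsc{BellmanFordDijkstra}(H,\phi)$ is run. If it finishes, the distances it computed are the new $\phi$ on $V(H)$; if it terminates early, the algorithm stops. *$\textsc{BellmanFordDijkstra}(H,\phi)$.* Add a source $s$ with $\phi(s)=0$ and zero-weight edges $sv$ to $H$. Each vertex is labelled with its current path from $s$, together with the path's weight in $H$ and its weight in $H_{\ge0}$; only the former is used for comparisons. At first only $s$ is labelled and queued. An iteration runs Dijkstra's algorithm from the queued vertices along the edges of nonnegative weight in $(H_s)_\phi$. If then some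 recorded path has weight more than $d$ in $H_{\ge0}$, the algorithm terminates early. Otherwise the negative edges of $(H_s)_\phi$ out of the vertices extracted in this iteration are relaxed once, and the vertices whose labels improved are queued for the next iteration; if there are none, the algorithm finishes. Time: elementary operations and queue insertions and key decreases cost $O(1)$, extracting a minimum from the queue costs $\log\log N$, where $N$ is the number of vertices of the graph. **Claim.** For every $c>0$ there is a constant $C>0$ such that the following holds for all $G$ and $W$ as above. Let $(H,d)$ be a non-leaf node of the decomposition tree (i.e. condition on the event, assumed to have positive probability, that $(H,d)$ is such a node; one may also condition further on any event, such as the success of the decompositions, whose conditional probability given this one is at least $1/2$), and suppose that $H$ contains no negative-weight cycle. A quantity of $\textsc{BellmanFordDijkstra}(H,\phi)$ counts as $0$ in an expectation if a leaf with a negative edge, or an early termination, at a descendant of $(H,d)$ prevents this run. Then: 1. The expected running time of $\textsc{BellmanFordDijkstra}(H,\phi)$ is at most $C\,(m_H+n_H\log\log n_H)\log n$. 2. One of the following two cases holds. * For every $v\in V(H)$ there is a shortest path to $v$ in $H$ whose weight in $H_{\ge0}$ is at most $d$; and for every $v\in V(H)$ the expectation of $\eta_{H,\phi}(v)$, the minimum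 number of negative edges of $H_\phi$ on a shortest path to $v$ in $H$, is at most $C\log n$. * For some $v\in V(H)$ every shortest path to $v$ in $H$ has weight more than $d$ in $H_{\ge0}$; and whenever $\textsc{BellmanFordDijkstra}(H,\phi)$ is run, it terminates early with a path $P$ in $H$ with $w_H(P)\le 0$ and $w_{H_{\ge0}}(P)>d$, after an expected number of at most $C\log n$ iterations. -/

import Mathlib

open MeasureTheory ProbabilityTheory
open scoped ENNReal

noncomputable section

open scoped Classical

namespace NegSSSP

/-! ### Directed graphs, walks, shortest paths -/

/-- A finite directed graph on (part of) the type `X`. Edge weights are kept separately, as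
functions `X × X → ℝ`. -/
structure DGraph (X : Type*) where
  verts : Finset X
  edges : Finset (X × X)

section Graphs

variable {X : Type*}

/-- The edges traversed by a vertex sequence. -/
def walkEdges (p : List X) : List (X × X) := p.zip p.tail

/-- A (potentially non-simple) directed path of `H`, as its nonempty sequence of vertices. The
one-vertex sequence is the empty path at that vertex. -/
def IsPath (H : DGraph X) (p : List X) : Prop :=
  p ≠ [] ∧ (∀ x ∈ p, x ∈ H.verts) ∧ p.IsChain (fun a b => (a, b) ∈ H.edges)

/-- The weight of a path, with multiplicity. -/
def pathWeight (w : X × X → ℝ) (p : List X) : ℝ := ((walkEdges p).map w).sum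

/-- `p` is a path of `H` ending at `v` (and starting anywhere). -/
def IsPathTo (H : DGraph X) (p : List X) (v : X) : Prop :=
  IsPath H p ∧ p.getLast? = some v

/-- `p` is a shortest one among all paths of `H` that end at `v`. -/
def IsShortestPathTo (H : DGraph X) (w : X × X → ℝ) (p : List X) (v : X) : Prop :=
  IsPathTo H p v ∧ ∀ q, IsPathTo H q v → pathWeight w p ≤ pathWeight w q

/-- `H` contains no negative-weight cycle. -/
def NoNegCycle (H : DGraph X) (w : X × X → ℝ) : Prop :=
  ∀ p, IsPath H p → p.head? = p.getLast? → 0 ≤ pathWeight w p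

/-- The weights of `G_{≥ 0}`: negative weights are replaced by `0`. -/
def nonnegPart (w : X × X → ℝ) : X × X → ℝ := fun e => max 0 (w e)

/-- The weights of `G_φ`. -/
def reweight (w : X × X → ℝ) (φ : X → ℝ) : X × X → ℝ := fun e => w e + φ e.1 - φ e.2

/-- Number of edges of `p` (with multiplicity) that have negative weight. -/
def negCount (w : X × X → ℝ) (p : List X) : ℕ :=
  (walkEdges p).countP (fun e => decide (w e < 0))

/-- `η_{H,φ}(v)`: the minimum number of edges of negative weight in `H_φ` among all shortest
paths in `H` ending at `v`. -/
def eta (H : DGraph X) (w : X × X → ℝ) (φ : X → ℝ) (v : X) : ℕ :=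
  sInf {j | ∃ p, IsShortestPathTo H w p v ∧ negCount (reweight w φ) p = j}

end Graphs

/-- `log n`, read as at least `1`. -/
def lg (n : ℕ) : ℝ := max 1 (Real.log n)

/-- `log log n`, read as at least `1`. -/
def lglg (n : ℕ) : ℝ := max 1 (Real.log (Real.log n))

/-! ### The Bellman-Ford/Dijkstra hybrid, with its running time -/

section BFD

variable {X : Type*}

/-- What the algorithm records for a vertex: the current path to it (last vertex first), and the
tuple of its weight and its auxiliary weight. -/
structure Label (X : Type*) where
  dist : ℝ
  aux : ℝ
  path : List X

inductive Status
  | running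
  | finished
  | aborted

structure BFDState (X : Type*) where
  /-- current labels (`none` = distance `∞`) -/
  label : X → Option (Label X)
  /-- contents of the priority queue -/
  queue : Finset X
  /-- vertices extracted from the queue during the current iteration -/
  marked : List X
  /-- number of the current iteration, starting with `1` -/
  iter : ℕ
  status : Status

/-- The current distance of a labelled vertex (junk value `0` for others). -/
def BFDState.dist (st : BFDState X) (x : X) : ℝ := ((st.label x).map Label.dist).getD 0

/-- `ℓ` has smaller distance than the label `o`. -/
def Label.Improves (ℓ : Label X) (o : Option (Label X)) : Prop :=
  ∀ ℓ₀, o = some ℓ₀ → ℓ.dist < ℓ₀.dist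

/-- Relax all those edges `(u, x)` of `G` that satisfy `sel`: the label of `u` is read from `src`,
and the labels `L` are updated. Only distances are compared. -/
def relax (G : DGraph X) (w aux : X × X → ℝ) (sel : X × X → Prop)
    (src : X → Option (Label X)) (u : X) (L : X → Option (Label X)) : X → Option (Label X) :=
  fun x =>
    match src u with
    | none => L x
    | some ℓ =>
      let ℓ' : Label X := ⟨ℓ.dist + w (u, x), ℓ.aux + aux (u, x), x :: ℓ.path⟩
      if (u, x) ∈ G.edges ∧ sel (u, x) ∧ ℓ'.Improves (L x) then some ℓ' else L x

/-- The vertex extracted from a nonempty queue: one of minimum key (ties are broken arbitrarily). -/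
def extractMin (key : X → ℝ) (Q : Finset X) (h : Q.Nonempty) : X :=
  (Finset.exists_min_image Q key h).choose

/-- Out-degree. -/
def outdeg (G : DGraph X) (u : X) : ℕ := (G.edges.filter (fun e => e.1 = u)).card

/-- Initially only the source `s` is labelled and queued. -/
def bfdInit (s : X) : BFDState X where
  label := fun x => if x = s then some ⟨0, 0, [s]⟩ else none
  queue := {s}
  marked := []
  iter := 1
  status := Status.running

/-- One step of the hybrid algorithm on `G` with weights `w` and potential `φ`, auxiliary weights
`aux` and threshold `d`.

Iteration `i` first runs Dijkstra's algorithm, started from the queued vertices, along the edges of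
nonnegative weight in `G_φ` (the key of a vertex is its distance in `G_φ`). When the queue has run
empty, the labels are `d_i` and `d'_i`. If a label has auxiliary weight more than `d`, the algorithm
terminates early. Otherwise the edges of negative weight in `G_φ` out of the vertices extracted in
this iteration are relaxed once, simultaneously, and the vertices whose labels have improved are
queued for iteration `i + 1`; if there are none, the algorithm is finished. -/
def bfdStep (G : DGraph X) (w : X × X → ℝ) (s : X) (φ : X → ℝ) (aux : X × X → ℝ) (d : ℝ)
    (st : BFDState X) : BFDState X :=
  match st.status with
  | Status.running =>
    if h : st.queue.Nonempty then
      let u := extractMin (fun x => st.dist x + φ s - φ x) st.queue h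
      let L := relax G w aux (fun e => 0 ≤ reweight w φ e) st.label u st.label
      { st with
        label := L
        queue := st.queue.erase u ∪ G.verts.filter (fun x => L x ≠ st.label x)
        marked := u :: st.marked }
    else if ∃ x ∈ G.verts, ∃ ℓ, st.label x = some ℓ ∧ d < ℓ.aux then
      { st with status := Status.aborted }
    else
      let L := st.marked.foldl
        (fun L u => relax G w aux (fun e => reweight w φ e < 0) st.label u L) st.label
      let Q := G.verts.filter (fun x => L x ≠ st.label x)
      if Q.Nonempty then
        { label := L, queue := Q, marked := [], iter := st.iter + 1, status := Status.running }
      else { st with status := Status.finished }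
  | _ => st

/-- The time taken by the next step. Elementary operations, and inserting into the queue or
decreasing a key there, take constant time; extracting a minimum takes time `log log n`.
* Extracting a vertex and scanning its out-edges: `log log n`, plus `1 +` its out-degree.
* End of an iteration (only the labels of vertices extracted in this iteration are new, hence have
  to be compared to the threshold, and only their out-edges have to be relaxed): `1`, plus
  `1 +` the out-degree of each of them. -/
def bfdStepTime (G : DGraph X) (s : X) (φ : X → ℝ) (st : BFDState X) : ℝ :=
  match st.status with
  | Status.running =>
    if h : st.queue.Nonempty then
      lglg G.verts.card + 1 +
        outdeg G (extractMin (fun x => st.dist x + φ s - φ x) st.queue h)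
    else 1 + (st.marked.map (fun u => 1 + (outdeg G u : ℝ))).sum
  | _ => 0

/-- The state after `t` steps. -/
def bfdRun (G : DGraph X) (w : X × X → ℝ) (s : X) (φ : X → ℝ) (aux : X × X → ℝ) (d : ℝ)
    (t : ℕ) : BFDState X :=
  (bfdStep G w s φ aux d)^[t] (bfdInit s)

/-- `H_s`: a source `none` is added to `H`, with an edge to every vertex. -/
def addSource (H : DGraph X) : DGraph (Option X) where
  verts := insert none (H.verts.image some)
  edges := H.edges.image (fun e => (some e.1, some e.2)) ∪
    H.verts.image (fun v => (none, some v))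

/-- Edge weights on `H_s`: the edges out of the source have weight `0`. -/
def extendWeight (w : X × X → ℝ) (e : Option X × Option X) : ℝ :=
  match e with
  | (some u, some v) => w (u, v)
  | _ => 0

/-- The potential on `H_s`: the source has potential `0`. -/
def extendPot (φ : X → ℝ) : Option X → ℝ := fun x => x.elim 0 φ

/-- The run of `BellmanFordDijkstra(H, φ)` with auxiliary weights `w_{H_{≥ 0}}` and threshold `d`:
its state after `t` steps. -/
def run (H : DGraph X) (w : X × X → ℝ) (φ : X → ℝ) (d : ℝ) (t : ℕ) : BFDState (Option X) :=
  bfdRun (addSource H) (extendWeight w) none (extendPot φ) (extendWeight (nonnegPart w)) d t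

/-- Running time of `BellmanFordDijkstra(H, φ)`, including the preparation of `H_s` and of the
reweighted edges (`∞` if the algorithm does not terminate). -/
def runTime (H : DGraph X) (w : X × X → ℝ) (φ : X → ℝ) (d : ℝ) : ℝ≥0∞ :=
  ((addSource H).verts.card + (addSource H).edges.card : ℕ) +
    ∑' t, ENNReal.ofReal (bfdStepTime (addSource H) none (extendPot φ)
      (run H w φ d t))

/-- Number of iterations performed by `BellmanFordDijkstra(H, φ)`. -/
def runIters (H : DGraph X) (w : X × X → ℝ) (φ : X → ℝ) (d : ℝ) : ℝ≥0∞ :=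
  ⨆ t, ((run H w φ d t).iter : ℝ≥0∞)

/-- `BellmanFordDijkstra(H, φ)` terminates early, having recorded a path `P` of `H`, of weight at
most `0` in `H` and of weight more than `d` in `H_{≥ 0}`. -/
def FindsLongPath (H : DGraph X) (w : X × X → ℝ) (φ : X → ℝ) (d : ℝ) : Prop :=
  ∃ t, (run H w φ d t).status = Status.aborted ∧
    ∃ (v : X) (P : List X) (ℓ : Label (Option X)),
      (run H w φ d t).label (some v) = some ℓ ∧ ℓ.path = P.reverse.map some ++ [none] ∧
      IsPathTo H P v ∧
      pathWeight w P = ℓ.dist ∧ pathWeight w P ≤ 0 ∧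
      pathWeight (nonnegPart w) P = ℓ.aux ∧ d < pathWeight (nonnegPart w) P

/-- The distances computed by `BellmanFordDijkstra(H, φ)`; `none` if it does not run to its regular
end. -/
def runResult (H : DGraph X) (w : X × X → ℝ) (φ : X → ℝ) (d : ℝ) : Option (X → ℝ) :=
  if h : ∃ t, (run H w φ d t).status = Status.finished then
    some (fun v => (run H w φ d h.choose).dist (some v))
  else none

end BFD

/-! ### The randomized subroutine `Decompose` -/

section Decompose

variable {V : Type*}

/-- The subgraph of `H` with the vertices in `A`. -/
def induce (H : DGraph V) (A : Finset V) : DGraph V :=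
  ⟨H.verts ∩ A, H.edges.filter (fun e => e.1 ∈ A ∧ e.2 ∈ A)⟩

/-- Out-ball of radius `r` centered at `v`. -/
def outBall (H : DGraph V) (w : V × V → ℝ) (v : V) (r : ℝ) : Finset V :=
  H.verts.filter (fun x => ∃ p, IsPathTo H p x ∧ p.head? = some v ∧ pathWeight w p ≤ r)

/-- In-ball of radius `r` centered at `v`. -/
def inBall (H : DGraph V) (w : V × V → ℝ) (v : V) (r : ℝ) : Finset V :=
  H.verts.filter (fun x => ∃ p, IsPathTo H p v ∧ p.head? = some x ∧ pathWeight w p ≤ r)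

/-- The geometric distribution on `{0, 1, 2, …}` with success probability `min (1, p)`. -/
def geometric (p : ℝ) : PMF ℕ :=
  (geometricMeasure (Set.projIcc (0 : ℝ) 1 zero_le_one p)).toPMF

/-- Carving: for the vertices `v` in the list, in this order, if `v` still belongs to the remaining
vertex set `A`, then remove from `A` a ball `B` centered at `v` in the remaining graph, of random
radius `j / 2` with `j` geometric of parameter `p`, and cut the edges in `cut A B`. The state is the
pair of `A` and the set of the edges cut so far. -/
def carve (H : DGraph V) (ball : DGraph V → V → ℝ → Finset V)
    (cut : Finset V → Finset V → Set (V × V)) (p : ℝ) :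
    List V → Finset V × Set (V × V) → PMF (Finset V × Set (V × V))
  | [], st => PMF.pure st
  | v :: l, st =>
    if v ∈ st.1 then
      (geometric p).bind fun j =>
        let B := ball (induce H st.1) v ((j : ℝ) / 2)
        carve H ball cut p l (st.1 \ B, st.2 ∪ cut st.1 B)
    else carve H ball cut p l st

/-- `Decompose(H, d)`, as the law of the set of cut edges. All distances are those of `H_{≥ 0}`
(`w` are the weights of `H`); `n` is the number of vertices of the original graph, and `c` the
constant that governs the probability of failure.

A uniform sample of `⌈c log n⌉` vertices of `H` (with replacement) estimates the sizes of the
balls of radius `d / 4`. A vertex is out-light (in-light) if its out-ball (in-ball) holds at most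
`5 / 8` of the sample. First out-balls centered at out-light vertices are carved out, cutting the
edges that leave the ball; then in-balls centered at in-light vertices, cutting the edges that enter
the ball. -/
def decompose (c : ℝ) (n : ℕ) (w : V × V → ℝ) (H : DGraph V) (d : ℝ) : PMF (Set (V × V)) :=
  if h : H.verts.Nonempty then
    haveI : Nonempty H.verts := h.to_subtype
    let N := ⌈c * lg n⌉₊
    let p := c * lg n / d
    let w' := nonnegPart w
    let cutOut : Finset V → Finset V → Set (V × V) :=
      fun A B => {e | e ∈ H.edges ∧ e.1 ∈ B ∧ e.2 ∈ A \ B}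
    let cutIn : Finset V → Finset V → Set (V × V) :=
      fun A B => {e | e ∈ H.edges ∧ e.1 ∈ A \ B ∧ e.2 ∈ B}
    (PMF.uniformOfFintype (Fin N → H.verts)).bind fun x =>
      let light (ball : DGraph V → V → ℝ → Finset V) : List V :=
        (H.verts.filter (fun v => (((Finset.univ : Finset (Fin N)).filter
          (fun i => (x i : V) ∈ ball H v (d / 4))).card : ℝ) ≤ 5 / 8 * N)).toList
      let outB : DGraph V → V → ℝ → Finset V := fun K v r => outBall K w' v r
      let inB : DGraph V → V → ℝ → Finset V := fun K v r => inBall K w' v r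
      (carve H outB cutOut p (light outB) (H.verts, ∅)).bind fun st =>
        (carve H inB cutIn p (light inB) st).map Prod.snd
  else PMF.pure ∅

end Decompose

/-! ### Strongly connected components and the adjustment of the potential -/

section SCC

variable {V : Type*}

/-- `H \ S`. -/
def deleteEdges (H : DGraph V) (S : Set (V × V)) : DGraph V :=
  ⟨H.verts, H.edges.filter (fun e => e ∉ S)⟩

/-- `b` can be reached from `a`. -/
def Reach (H : DGraph V) : V → V → Prop :=
  Relation.ReflTransGen (fun a b => (a, b) ∈ H.edges)

/-- The strongly connected component of `v` in `H`, as a subgraph of `H`. -/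
def scc (H : DGraph V) (v : V) : DGraph V :=
  induce H (H.verts.filter (fun x => Reach H v x ∧ Reach H x v))

/-- `τ` numbers the strongly connected components in a topological order. -/
def IsTopological (H : DGraph V) (τ : V → ℕ) : Prop :=
  ∀ e ∈ H.edges, (Reach H e.2 e.1 → τ e.1 = τ e.2) ∧ (¬ Reach H e.2 e.1 → τ e.1 < τ e.2)

theorem exists_isTopological [Fintype V] (H : DGraph V) : ∃ τ : V → ℕ, IsTopological H τ := by
  refine ⟨fun v => (Finset.univ.filter (fun x => Reach H x v)).card, fun e he => ⟨fun h => ?_,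
    fun h => ?_⟩⟩
  · have h1 : Reach H e.1 e.2 := Relation.ReflTransGen.single he
    have : (Finset.univ.filter (fun x => Reach H x e.1)) =
        (Finset.univ.filter (fun x => Reach H x e.2)) := by
      ext x
      simp only [Finset.mem_filter, Finset.mem_univ, true_and]
      exact ⟨fun hx => Relation.ReflTransGen.trans hx h1,
        fun hx => Relation.ReflTransGen.trans hx h⟩
    simp only [this]
  · have h1 : Reach H e.1 e.2 := Relation.ReflTransGen.single he
    apply Finset.card_lt_card
    rw [Finset.ssubset_iff_of_subset]
    · exact ⟨e.2, Finset.mem_filter.mpr ⟨Finset.mem_univ _, Relation.ReflTransGen.refl⟩, by simpa using h⟩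
    · intro x hx
      simp only [Finset.mem_filter, Finset.mem_univ, true_and] at hx ⊢
      exact Relation.ReflTransGen.trans hx h1

/-- Adjusts `φ` so that edges between strongly connected components get nonnegative weights: in a
topological order of the components, the potential on the `j`-th component is changed by
`μ_0 + … + μ_j`, where `μ_j ≤ 0` is the smallest weight in `H_φ` of an edge that enters the `j`-th
component from another one (and `0` if none of them is negative). -/
def fixDAG [Fintype V] (H : DGraph V) (w : V × V → ℝ) (φ : V → ℝ) : V → ℝ :=
  let τ := (exists_isTopological H).choose
  let μ : ℕ → ℝ := fun j =>
    (H.edges.filter (fun e => ¬ Reach H e.2 e.1 ∧ τ e.2 = j)).fold min 0 (reweight w φ)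
  fun v => φ v + ∑ j ∈ Finset.range (τ v + 1), μ j

end SCC

/-! ### The algorithm `Scale` -/

section Scale

variable {V : Type*} [Fintype V]

/-- The weights of the scaled graph `G'`: every weight is increased by `W / 2`. -/
def scaledWeight (wG : V × V → ℤ) (W : ℕ) : V × V → ℝ := fun e => (wG e : ℝ) + (W : ℝ) / 2

/-- The diameter parameters: `d₀ = nW/2`, halved `k` times. -/
def diam (n W k : ℕ) : ℝ := (n : ℝ) * W / 2 / 2 ^ k

/-- The random choices of the algorithm. Each call of `Decompose(H, d)`, where `d` is `d₀` halved
`k` times, has its own entry in a table of independent cut sets. In one execution no call occurs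
twice, and `k ≤ n` in all of them, so that using the table is the same as using fresh randomness in
each call. -/
abbrev Table (V : Type*) [Fintype V] : Type _ :=
  Finset V × Finset (V × V) × Fin (Fintype.card V + 1) → Set (V × V)

/-- The law of the table: independent entries, with the law of `Decompose(H, d)` each. -/
def tableLaw (c : ℝ) (wG : V × V → ℤ) (W : ℕ) : Measure (Table V) :=
  Measure.pi fun key =>
    (decompose c (Fintype.card V) (scaledWeight wG W) ⟨key.1, key.2.1⟩
      (diam (Fintype.card V) W key.2.2)).toMeasure

/-- `S_{(H, d)}`, where `d` is `d₀` halved `k` times. -/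
def cutSet (ω : Table V) (H : DGraph V) (k : ℕ) : Set (V × V) :=
  ω (H.verts, H.edges, Fin.ofNat (Fintype.card V + 1) k)

/-- The component of `H \ S_{(H, d)}` that contains `v`. -/
def childGraph (ω : Table V) (H : DGraph V) (k : ℕ) (v : V) : DGraph V :=
  scc (deleteEdges H (cutSet ω H k)) v

/-- The diameter parameter of that component: the same one if the component has at most `3/4` of the
vertices of `H`, and half of it otherwise. -/
def childIdx (ω : Table V) (H : DGraph V) (k : ℕ) (v : V) : ℕ :=
  if ((childGraph ω H k v).verts.card : ℝ) ≤ 3 / 4 * H.verts.card then k else k + 1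

/-- `(H, d)`, where `d` is `d₀` halved `k` times, is a non-leaf node of the decomposition tree of
the graph with edge set `E`. -/
inductive IsNode (E : Finset (V × V)) (W : ℕ) (ω : Table V) : DGraph V → ℕ → Prop
  | root : IsNode E W ω ⟨Finset.univ, E⟩ 0
  | child (H : DGraph V) (k : ℕ) (v : V) : IsNode E W ω H k → v ∈ H.verts →
      (W : ℝ) / 2 < diam (Fintype.card V) W (childIdx ω H k v) →
      IsNode E W ω (childGraph ω H k v) (childIdx ω H k v)

theorem childGraph_card_le (ω : Table V) (H : DGraph V) (k : ℕ) (v : V) :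
    (childGraph ω H k v).verts.card ≤ H.verts.card :=
  Finset.card_le_card (fun _ hx => (Finset.mem_inter.mp hx).1)

theorem child_decreases (W : ℕ) (ω : Table V) (H : DGraph V) (k : ℕ) (v : V) (hv : v ∈ H.verts)
    (h : (W : ℝ) / 2 < diam (Fintype.card V) W (childIdx ω H k v)) :
    (childGraph ω H k v).verts.card + (Fintype.card V - childIdx ω H k v) <
      H.verts.card + (Fintype.card V - k) := by
  have hle := childGraph_card_le ω H k v
  have hpos : 0 < H.verts.card := Finset.card_pos.mpr ⟨v, hv⟩
  unfold childIdx at h ⊢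
  split_ifs at h ⊢ with hc
  · have hlt : (childGraph ω H k v).verts.card < H.verts.card := by
      have h1 : (0 : ℝ) < H.verts.card := by exact_mod_cast hpos
      have h2 : ((childGraph ω H k v).verts.card : ℝ) < H.verts.card := by linarith
      exact_mod_cast h2
    omega
  · have hk : k + 1 < Fintype.card V := by
      by_contra hk
      have h2 : Fintype.card V ≤ 2 ^ (k + 1) :=
        (not_lt.mp hk).trans (Nat.lt_two_pow_self).le
      have h3 : (Fintype.card V : ℝ) ≤ 2 ^ (k + 1) := by exact_mod_cast h2
      have h4 : diam (Fintype.card V) W (k + 1) ≤ (W : ℝ) / 2 := by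
        unfold diam
        rw [div_le_iff₀ (by positivity)]
        have : (0 : ℝ) ≤ W := Nat.cast_nonneg W
        nlinarith
      linarith
    omega

/-- The potential `φ` with which the algorithm runs `BellmanFordDijkstra(H, φ)` at the non-leaf node
`(H, d)` (where `d` is `d₀` halved `k` times), after all nodes below it have been processed and the
edges between the components of `H \ S_{(H, d)}` have been fixed. It is `none` if the
algorithm does not get to this point, since a leaf below the node has a negative edge or a run of
`BellmanFordDijkstra` below the node has terminated early.

On each component, the potential is the one computed at the corresponding child: the distances if
the child is not a leaf, and the initial value `0` if it is one. -/
def potentialAt (w : V × V → ℝ) (W : ℕ) (ω : Table V) (H : DGraph V) (k : ℕ) :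
    Option (V → ℝ) :=
  let child : H.verts → Option (V → ℝ) := fun v =>
    if h : (W : ℝ) / 2 < diam (Fintype.card V) W (childIdx ω H k v) then
      (potentialAt w W ω (childGraph ω H k v) (childIdx ω H k v)).bind fun φ =>
        runResult (childGraph ω H k v) w φ (diam (Fintype.card V) W (childIdx ω H k v))
    else if ∃ e ∈ (childGraph ω H k v).edges, w e < 0 then none
    else some (fun _ => 0)
  if ∀ v, (child v).isSome then
    some (fixDAG (deleteEdges H (cutSet ω H k)) w
      (fun v => if hv : v ∈ H.verts then (child ⟨v, hv⟩).getD 0 v else 0))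
  else none
termination_by H.verts.card + (Fintype.card V - k)
decreasing_by exact child_decreases W ω H k v v.2 h

/-- The time spent in `BellmanFordDijkstra(H, φ)` at the node `(H, d)` (it is `0` if the algorithm
does not get there). -/
def timeAt (w : V × V → ℝ) (W : ℕ) (H : DGraph V) (k : ℕ) (ω : Table V) : ℝ≥0∞ :=
  match potentialAt w W ω H k with
  | none => 0
  | some φ => runTime H w φ (diam (Fintype.card V) W k)

/-- The number of iterations of `BellmanFordDijkstra(H, φ)` at the node `(H, d)` (it is `0` if
the algorithm does not get there). -/
def itersAt (w : V × V → ℝ) (W : ℕ) (H : DGraph V) (k : ℕ) (ω : Table V) : ℝ≥0∞ :=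
  match potentialAt w W ω H k with
  | none => 0
  | some φ => runIters H w φ (diam (Fintype.card V) W k)

/-- `η_{H,φ}(v)` at the node `(H, d)` (it is `0` if the algorithm does not get there). -/
def etaAt (w : V × V → ℝ) (W : ℕ) (H : DGraph V) (k : ℕ) (v : V) (ω : Table V) : ℝ≥0∞ :=
  match potentialAt w W ω H k with
  | none => 0
  | some φ => (eta H w φ v : ℝ≥0∞)

end Scale

end NegSSSP

end

open NegSSSP

/-!
At a node `(H, d)`, the potential `φ` is at most `0`, and makes all edges nonnegative but those cut by
`Decompose(H, d)` (`potentialAt_spec`): distances computed by a complete run make the edges inside a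
component nonnegative (`runResult_spec`), and lowering `φ` in a topological order repairs the edges
between components (`reweight_fixDAG_nonneg`). So the number of negative edges of `H_φ` on a path
is at most the number of its edges that are cut.

An edge of weight `x` in `H_{≥ 0}` is cut with probability at most `4 x c log n / d` (`decompose_le`):
weights are half-integral and radii geometric, hence memoryless, so the first ball that reaches one
endpoint fails to contain the other one with probability at most `2 x c log n / d`, in each of the two
phases. Whether `(H, d)` is a node depends on the cuts at other nodes only (`IsNode.congr`), so that
conditioning on this event changes nothing, and conditioning on a further event of probability at
least `1 / 2` costs a factor `2` (`cond_cutSet_le`). A path fixed in advance of weight at most `d` in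
`H_{≥ 0}` thus has at most `8 c log n` cut edges in expectation (`lintegral_count_cut_le`).

It remains to analyse `BellmanFordDijkstra(H, φ)` for a fixed `φ` (`BFDInv`). After iteration `i`,
labels are at least as good as all walks with fewer than `i` negative edges, and no vertex is
extracted twice in an iteration. If a shortest path to `v` has `K` negative edges, then `v` is
extracted in the first `K + 1` iterations only (`iter_le_of_mem_marked`), and the time is bounded
by charging everything to the extractions (`sum_bfdStepTime_le`). If shortest paths of weight at most
`d` in `H_{≥ 0}` exist for all vertices, these bounds give the claims. Otherwise some vertex `z` has
long shortest paths only, one of which is a path `q` of weight at most `d` followed by one edge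
(`exists_critical_edge`). Once `z` has its final label, the run terminates early, and this happens
after at most `2` iterations more than `q` has negative edges (`run_iter_le_of_critical`).
-/

noncomputable section

open scoped Classical

namespace NegSSSP

/-! ### Labels and source walks of the hybrid algorithm -/

section BFDAnalysis

variable {X : Type*} {G : DGraph X} {w : X × X → ℝ} {s : X} {φ : X → ℝ} {aux : X × X → ℝ} {d : ℝ}

/-- `SourceWalk G w s φ aux j x ℓ`: `ℓ` is the label of a walk of `G` from `s` to `x`, exactly `j`
edges of which have negative weight in `G_φ`. -/
inductive SourceWalk (G : DGraph X) (w : X × X → ℝ) (s : X) (φ : X → ℝ) (aux : X × X → ℝ) :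
    ℕ → X → Label X → Prop
  | nil : SourceWalk G w s φ aux 0 s ⟨0, 0, [s]⟩
  | cons {j : ℕ} {u : X} {ℓ : Label X} {x : X} : SourceWalk G w s φ aux j u ℓ → (u, x) ∈ G.edges →
      SourceWalk G w s φ aux (j + if reweight w φ (u, x) < 0 then 1 else 0) x
        ⟨ℓ.dist + w (u, x), ℓ.aux + aux (u, x), x :: ℓ.path⟩

/-- The label `o` exists and has distance at most `r`. -/
def LabelLE (o : Option (Label X)) (r : ℝ) : Prop := ∃ ℓ, o = some ℓ ∧ ℓ.dist ≤ r

theorem LabelLE.mono {o : Option (Label X)} {r r' : ℝ} (h : LabelLE o r) (hr : r ≤ r') :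
    LabelLE o r' := by
  obtain ⟨ℓ, h1, h2⟩ := h
  exact ⟨ℓ, h1, h2.trans hr⟩

theorem relax_cases (sel : X × X → Prop) (src : X → Option (Label X)) (u : X)
    (L : X → Option (Label X)) (x : X) :
    relax G w aux sel src u L x = L x ∨ ∃ ℓ, src u = some ℓ ∧ (u, x) ∈ G.edges ∧ sel (u, x) ∧
      Label.Improves ⟨ℓ.dist + w (u, x), ℓ.aux + aux (u, x), x :: ℓ.path⟩ (L x) ∧
      relax G w aux sel src u L x =
        some ⟨ℓ.dist + w (u, x), ℓ.aux + aux (u, x), x :: ℓ.path⟩ := by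
  unfold relax
  cases hs : src u with
  | none => exact Or.inl rfl
  | some ℓ =>
    by_cases h : (u, x) ∈ G.edges ∧ sel (u, x) ∧
      Label.Improves ⟨ℓ.dist + w (u, x), ℓ.aux + aux (u, x), x :: ℓ.path⟩ (L x)
    · exact Or.inr ⟨ℓ, rfl, h.1, h.2.1, h.2.2, if_pos h⟩
    · exact Or.inl (if_neg h)

theorem LabelLE.relax {sel : X × X → Prop} {src : X → Option (Label X)} {u : X}
    {L : X → Option (Label X)} {x : X} {r : ℝ} (h : LabelLE (L x) r) :
    LabelLE (relax G w aux sel src u L x) r := by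
  rcases relax_cases (G := G) (w := w) (aux := aux) sel src u L x with h1 | ⟨ℓ, -, -, -, h1, h2⟩
  · rwa [h1]
  · obtain ⟨ℓ₀, h3, h4⟩ := h
    exact ⟨_, h2, (h1 ℓ₀ h3).le.trans h4⟩

theorem labelLE_relax_of_edge {sel : X × X → Prop} {src : X → Option (Label X)} {u : X}
    {L : X → Option (Label X)} {x : X} {ℓ : Label X} (hu : src u = some ℓ)
    (he : (u, x) ∈ G.edges) (hsel : sel (u, x)) :
    LabelLE (relax G w aux sel src u L x) (ℓ.dist + w (u, x)) := by
  unfold NegSSSP.relax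
  simp only [hu]
  split_ifs with h
  · exact ⟨_, rfl, le_rfl⟩
  · have : ¬ Label.Improves ⟨ℓ.dist + w (u, x), ℓ.aux + aux (u, x), x :: ℓ.path⟩ (L x) :=
      fun hI => h ⟨he, hsel, hI⟩
    unfold Label.Improves at this
    push Not at this
    obtain ⟨ℓ₀, h1, h2⟩ := this
    exact ⟨ℓ₀, h1, h2⟩

/-- The labels after the edges selected by `sel` out of the vertices in `l` have been relaxed
simultaneously. -/
abbrev relaxAll (G : DGraph X) (w aux : X × X → ℝ) (sel : X × X → Prop)
    (src : X → Option (Label X)) (l : List X) (L : X → Option (Label X)) : X → Option (Label X) :=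
  l.foldl (fun L u => relax G w aux sel src u L) L

theorem LabelLE.relaxAll {sel : X × X → Prop} {src : X → Option (Label X)} (l : List X)
    {L : X → Option (Label X)} {x : X} {r : ℝ} (h : LabelLE (L x) r) :
    LabelLE (relaxAll G w aux sel src l L x) r := by
  induction l generalizing L with
  | nil => exact h
  | cons u l ih => exact ih h.relax

theorem labelLE_relaxAll_of_edge {sel : X × X → Prop} {src : X → Option (Label X)} {l : List X}
    {L : X → Option (Label X)} {u x : X} {ℓ : Label X} (hul : u ∈ l) (hu : src u = some ℓ)
    (he : (u, x) ∈ G.edges) (hsel : sel (u, x)) :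
    LabelLE (relaxAll G w aux sel src l L x) (ℓ.dist + w (u, x)) := by
  induction l generalizing L with
  | nil => simp at hul
  | cons a l ih =>
    rcases List.mem_cons.mp hul with rfl | h
    · exact LabelLE.relaxAll l (labelLE_relax_of_edge hu he hsel)
    · exact ih h

theorem relaxAll_cases (sel : X × X → Prop) (src : X → Option (Label X)) (l : List X)
    (L : X → Option (Label X)) (x : X) :
    relaxAll G w aux sel src l L x = L x ∨ ∃ u ∈ l, ∃ ℓ, src u = some ℓ ∧ (u, x) ∈ G.edges ∧
      sel (u, x) ∧ Label.Improves ⟨ℓ.dist + w (u, x), ℓ.aux + aux (u, x), x :: ℓ.path⟩ (L x) ∧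
      relaxAll G w aux sel src l L x =
        some ⟨ℓ.dist + w (u, x), ℓ.aux + aux (u, x), x :: ℓ.path⟩ := by
  induction l generalizing L with
  | nil => exact Or.inl rfl
  | cons a l ih =>
    rcases ih (relax G w aux sel src a L) with h | ⟨u, hu, ℓ, h1, h2, h3, h4, h5⟩
    · rcases relax_cases (G := G) (w := w) (aux := aux) sel src a L x with
        h' | ⟨ℓ, h1, h2, h3, h4, h5⟩
      · exact Or.inl (h.trans h')
      · exact Or.inr ⟨a, List.mem_cons_self, ℓ, h1, h2, h3, h4, h.trans h5⟩
    · refine Or.inr ⟨u, List.mem_cons_of_mem _ hu, ℓ, h1, h2, h3, ?_, h5⟩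
      rcases relax_cases (G := G) (w := w) (aux := aux) sel src a L x with
        h' | ⟨ℓ', -, -, -, h6, h7⟩
      · rwa [h'] at h4
      · intro ℓ₀ h0
        exact (h4 _ h7).trans (h6 ℓ₀ h0)

/-! ### The steps of the hybrid algorithm -/

/-- The key by which the queue is ordered. -/
abbrev BFDState.key (s : X) (φ : X → ℝ) (st : BFDState X) (x : X) : ℝ := st.dist x + φ s - φ x

theorem BFDState.dist_eq {st : BFDState X} {x : X} {ℓ : Label X} (h : st.label x = some ℓ) :
    st.dist x = ℓ.dist := by
  simp [BFDState.dist, h]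

theorem extractMin_mem {key : X → ℝ} {Q : Finset X} (h : Q.Nonempty) : extractMin key Q h ∈ Q :=
  (Finset.exists_min_image Q key h).choose_spec.1

theorem extractMin_le {key : X → ℝ} {Q : Finset X} (h : Q.Nonempty) {x : X} (hx : x ∈ Q) :
    key (extractMin key Q h) ≤ key x :=
  (Finset.exists_min_image Q key h).choose_spec.2 x hx

/-- The labels after the nonnegative edges out of the extracted vertex `u` have been relaxed. -/
abbrev dijkstraLabel (G : DGraph X) (w : X × X → ℝ) (φ : X → ℝ) (aux : X × X → ℝ)
    (st : BFDState X) (u : X) : X → Option (Label X) :=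
  relax G w aux (fun e => 0 ≤ reweight w φ e) st.label u st.label

/-- The labels after the negative edges out of all vertices extracted in the current iteration have
been relaxed. -/
abbrev fordLabel (G : DGraph X) (w : X × X → ℝ) (φ : X → ℝ) (aux : X × X → ℝ)
    (st : BFDState X) : X → Option (Label X) :=
  relaxAll G w aux (fun e => reweight w φ e < 0) st.label st.marked st.label

/-- The state after the vertex `u` has been extracted from the queue of `st`. -/
abbrev extractState (G : DGraph X) (w : X × X → ℝ) (φ : X → ℝ) (aux : X × X → ℝ)
    (st : BFDState X) (u : X) : BFDState X :=
  { st with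
    label := dijkstraLabel G w φ aux st u
    queue := st.queue.erase u ∪ G.verts.filter (fun x => dijkstraLabel G w φ aux st u x ≠ st.label x)
    marked := u :: st.marked }

/-- The state at the beginning of the iteration that follows the one completed by `st`. -/
abbrev nextState (G : DGraph X) (w : X × X → ℝ) (φ : X → ℝ) (aux : X × X → ℝ)
    (st : BFDState X) : BFDState X :=
  { label := fordLabel G w φ aux st
    queue := G.verts.filter (fun x => fordLabel G w φ aux st x ≠ st.label x)
    marked := []
    iter := st.iter + 1
    status := Status.running }

/-- `BFDStep G w s φ aux d st st' τ`: the next step turns `st` into `st'` and takes time `τ`. -/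
inductive BFDStep (G : DGraph X) (w : X × X → ℝ) (s : X) (φ : X → ℝ) (aux : X × X → ℝ) (d : ℝ)
    (st : BFDState X) : BFDState X → ℝ → Prop
  | halted : st.status ≠ Status.running → BFDStep G w s φ aux d st st 0
  | extract (u : X) (hQ : st.queue.Nonempty) : st.status = Status.running →
      u = extractMin (st.key s φ) st.queue hQ →
      BFDStep G w s φ aux d st (extractState G w φ aux st u) (lglg G.verts.card + 1 + outdeg G u)
  | abort : st.status = Status.running → st.queue = ∅ →
      (∃ x ∈ G.verts, ∃ ℓ, st.label x = some ℓ ∧ d < ℓ.aux) →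
      BFDStep G w s φ aux d st { st with status := Status.aborted }
        (1 + (st.marked.map (fun u => 1 + (outdeg G u : ℝ))).sum)
  | next : st.status = Status.running → st.queue = ∅ →
      (∀ x ∈ G.verts, ∀ ℓ, st.label x = some ℓ → ℓ.aux ≤ d) →
      (∃ x ∈ G.verts, fordLabel G w φ aux st x ≠ st.label x) →
      BFDStep G w s φ aux d st (nextState G w φ aux st)
        (1 + (st.marked.map (fun u => 1 + (outdeg G u : ℝ))).sum)
  | finish : st.status = Status.running → st.queue = ∅ →
      (∀ x ∈ G.verts, ∀ ℓ, st.label x = some ℓ → ℓ.aux ≤ d) →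
      (∀ x ∈ G.verts, fordLabel G w φ aux st x = st.label x) →
      BFDStep G w s φ aux d st { st with status := Status.finished }
        (1 + (st.marked.map (fun u => 1 + (outdeg G u : ℝ))).sum)

theorem bfdStep_spec (G : DGraph X) (w : X × X → ℝ) (s : X) (φ : X → ℝ) (aux : X × X → ℝ) (d : ℝ)
    (st : BFDState X) :
    BFDStep G w s φ aux d st (bfdStep G w s φ aux d st) (bfdStepTime G s φ st) := by
  unfold bfdStep bfdStepTime
  cases hst : st.status with
  | running =>
    simp only
    split_ifs with hQ hA hN
    · have := BFDStep.extract (G := G) (w := w) (s := s) (φ := φ) (aux := aux) (d := d) (st := st)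
        _ hQ hst rfl
      simpa only [extractState, hst] using this
    · exact BFDStep.abort hst (Finset.not_nonempty_iff_eq_empty.mp hQ) hA
    · push Not at hA
      obtain ⟨x, hx⟩ := hN
      exact BFDStep.next hst (Finset.not_nonempty_iff_eq_empty.mp hQ) hA
        ⟨x, (Finset.mem_filter.mp hx).1, (Finset.mem_filter.mp hx).2⟩
    · push Not at hA
      refine BFDStep.finish hst (Finset.not_nonempty_iff_eq_empty.mp hQ) hA ?_
      intro x hx
      by_contra hne
      exact hN ⟨x, Finset.mem_filter.mpr ⟨hx, hne⟩⟩
  | finished => exact BFDStep.halted (by simp [hst])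
  | aborted => exact BFDStep.halted (by simp [hst])

theorem bfdRun_succ (G : DGraph X) (w : X × X → ℝ) (s : X) (φ : X → ℝ) (aux : X × X → ℝ) (d : ℝ)
    (t : ℕ) : bfdRun G w s φ aux d (t + 1) = bfdStep G w s φ aux d (bfdRun G w s φ aux d t) :=
  Function.iterate_succ_apply' _ _ _

/-- A property of states that holds initially and is preserved by every step holds throughout the
run. -/
theorem bfdRun_induction {P : BFDState X → Prop} (h0 : P (bfdInit s))
    (hstep : ∀ st st' τ, P st → BFDStep G w s φ aux d st st' τ → P st') (t : ℕ) :
    P (bfdRun G w s φ aux d t) := by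
  induction t with
  | zero => exact h0
  | succ t ih =>
    rw [bfdRun_succ]
    exact hstep _ _ _ ih (bfdStep_spec G w s φ aux d _)

/-! ### Invariants of the hybrid algorithm -/

/-- The source is a vertex, and the endpoints of all edges are vertices. -/
structure WellFormed (G : DGraph X) (s : X) : Prop where
  source_mem : s ∈ G.verts
  fst_mem : ∀ {e}, e ∈ G.edges → e.1 ∈ G.verts
  snd_mem : ∀ {e}, e ∈ G.edges → e.2 ∈ G.verts

/-- The invariants of the run. The fields `dijkstra` and `ford` say which edges are relaxed. By
`progress` and `progress_neg`, the labels in iteration `i` are at least as good as all walks with at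
most `i - 2` negative edges, and as all walks that consist of such a walk and one more negative edge;
`sep` is Dijkstra's invariant that vertices are extracted by increasing keys. -/
structure BFDInv (G : DGraph X) (w : X × X → ℝ) (s : X) (φ : X → ℝ) (aux : X × X → ℝ)
    (st : BFDState X) : Prop where
  walk : ∀ x ℓ, st.label x = some ℓ → ∃ j, SourceWalk G w s φ aux j x ℓ
  queue_mem : ∀ x ∈ st.queue, x ∈ G.verts
  queue_label : ∀ x ∈ st.queue, ∃ ℓ, st.label x = some ℓ
  marked_mem : ∀ x ∈ st.marked, x ∈ G.verts
  marked_label : ∀ x ∈ st.marked, ∃ ℓ, st.label x = some ℓ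
  dijkstra : ∀ x ℓ y, st.label x = some ℓ → x ∉ st.queue → (x, y) ∈ G.edges →
    0 ≤ reweight w φ (x, y) → LabelLE (st.label y) (ℓ.dist + w (x, y))
  ford : ∀ x ℓ y, st.label x = some ℓ → x ∉ st.queue → x ∉ st.marked → (x, y) ∈ G.edges →
    reweight w φ (x, y) < 0 → LabelLE (st.label y) (ℓ.dist + w (x, y))
  progress : ∀ j x ℓ, SourceWalk G w s φ aux j x ℓ → j + 1 < st.iter →
    LabelLE (st.label x) ℓ.dist
  progress_neg : ∀ j u ℓ x, SourceWalk G w s φ aux j u ℓ → j + 1 < st.iter → (u, x) ∈ G.edges →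
    reweight w φ (u, x) < 0 → LabelLE (st.label x) (ℓ.dist + w (u, x))
  source : LabelLE (st.label s) 0
  iter_pos : 1 ≤ st.iter
  sep : ∀ m ∈ st.marked, ∀ x ∈ st.queue, st.dist m - φ m ≤ st.dist x - φ x
  disj : ∀ m ∈ st.marked, m ∉ st.queue
  nodup : st.marked.Nodup
  nonempty : st.queue.Nonempty ∨ st.marked ≠ []

theorem bfdInv_init (hG : WellFormed G s) : BFDInv G w s φ aux (bfdInit s) where
  walk x ℓ h := by
    simp only [bfdInit] at h
    split_ifs at h with hx
    subst hx
    cases h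
    exact ⟨0, SourceWalk.nil⟩
  queue_mem x hx := by
    rw [Finset.mem_singleton.mp hx]
    exact hG.source_mem
  queue_label x hx := by
    rw [Finset.mem_singleton.mp hx]
    exact ⟨_, if_pos rfl⟩
  marked_mem x hx := by simp [bfdInit] at hx
  marked_label x hx := by simp [bfdInit] at hx
  dijkstra x ℓ y h hx := by
    simp only [bfdInit] at h hx
    split_ifs at h with hxs
    simp [hxs] at hx
  ford x ℓ y h hx := by
    simp only [bfdInit] at h hx
    split_ifs at h with hxs
    simp [hxs] at hx
  progress j x ℓ _ h := by simp [bfdInit] at h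
  progress_neg j u ℓ x _ h := by simp [bfdInit] at h
  source := ⟨_, if_pos rfl, le_rfl⟩
  iter_pos := le_rfl
  sep m hm := by simp [bfdInit] at hm
  disj m hm := by simp [bfdInit] at hm
  nodup := List.nodup_nil
  nonempty := Or.inl (Finset.singleton_nonempty s)

theorem dijkstraLabel_changed {st : BFDState X} {u x : X}
    (h : dijkstraLabel G w φ aux st u x ≠ st.label x) :
    ∃ ℓ, st.label u = some ℓ ∧ (u, x) ∈ G.edges ∧ 0 ≤ reweight w φ (u, x) ∧
      Label.Improves ⟨ℓ.dist + w (u, x), ℓ.aux + aux (u, x), x :: ℓ.path⟩ (st.label x) ∧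
      dijkstraLabel G w φ aux st u x =
        some ⟨ℓ.dist + w (u, x), ℓ.aux + aux (u, x), x :: ℓ.path⟩ :=
  (relax_cases _ _ _ _ _).resolve_left h

theorem fordLabel_changed {st : BFDState X} {x : X}
    (h : fordLabel G w φ aux st x ≠ st.label x) :
    ∃ u ∈ st.marked, ∃ ℓ, st.label u = some ℓ ∧ (u, x) ∈ G.edges ∧ reweight w φ (u, x) < 0 ∧
      Label.Improves ⟨ℓ.dist + w (u, x), ℓ.aux + aux (u, x), x :: ℓ.path⟩ (st.label x) ∧
      fordLabel G w φ aux st x =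
        some ⟨ℓ.dist + w (u, x), ℓ.aux + aux (u, x), x :: ℓ.path⟩ :=
  (relaxAll_cases _ _ _ _ _).resolve_left h

/-- The label of a vertex that has been extracted in the current iteration is final for this
iteration: it cannot be improved via an extracted vertex of larger key and a nonnegative edge. -/
theorem dijkstraLabel_eq {st : BFDState X} {u x : X} (hlab : ∃ ℓ, st.label x = some ℓ)
    (hkey : st.dist x - φ x ≤ st.dist u - φ u) :
    dijkstraLabel G w φ aux st u x = st.label x := by
  by_contra h
  obtain ⟨ℓ, h1, -, h2, h3, -⟩ := dijkstraLabel_changed h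
  obtain ⟨ℓ₀, h4⟩ := hlab
  have h5 := h3 ℓ₀ h4
  rw [BFDState.dist_eq h4, BFDState.dist_eq h1] at hkey
  simp only [reweight] at h2 h5
  linarith

theorem BFDInv.extract (hG : WellFormed G s) {st : BFDState X} (h : BFDInv G w s φ aux st)
    (hQ : st.queue.Nonempty) {u : X} (hu : u = extractMin (st.key s φ) st.queue hQ) :
    BFDInv G w s φ aux (extractState G w φ aux st u) := by
  have huQ : u ∈ st.queue := hu ▸ extractMin_mem hQ
  have hmin : ∀ x ∈ st.queue, st.dist u - φ u ≤ st.dist x - φ x := by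
    intro x hx
    have := extractMin_le (key := st.key s φ) hQ hx
    rw [← hu] at this
    simp only [BFDState.key] at this
    linarith
  obtain ⟨ℓu, hℓu⟩ := h.queue_label u huQ
  have hfix : ∀ m ∈ u :: st.marked, dijkstraLabel G w φ aux st u m = st.label m := by
    intro m hm
    rcases List.mem_cons.mp hm with rfl | hm
    · exact dijkstraLabel_eq ⟨_, hℓu⟩ le_rfl
    · exact dijkstraLabel_eq (h.marked_label m hm) (h.sep m hm u huQ)
  have hmono : ∀ {x r}, LabelLE (st.label x) r →
      LabelLE ((extractState G w φ aux st u).label x) r := fun hx =>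
    LabelLE.relax (sel := fun e => 0 ≤ reweight w φ e) hx
  have hmemQ : ∀ x, x ∈ (extractState G w φ aux st u).queue ↔
      (x ≠ u ∧ x ∈ st.queue) ∨ (x ∈ G.verts ∧ dijkstraLabel G w φ aux st u x ≠ st.label x) := by
    intro x
    simp
  have hnot : ∀ x, x ∉ (extractState G w φ aux st u).queue →
      (x = u ∨ x ∉ st.queue) ∧ dijkstraLabel G w φ aux st u x = st.label x := by
    intro x hx
    rw [hmemQ] at hx
    push Not at hx
    refine ⟨?_, ?_⟩
    · by_cases hxu : x = u
      · exact Or.inl hxu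
      · exact Or.inr (hx.1 hxu)
    · by_contra hne
      obtain ⟨ℓ, -, h2, -⟩ := dijkstraLabel_changed hne
      exact hne (hx.2 (hG.snd_mem h2))
  refine ⟨?_, ?_, ?_, ?_, ?_, ?_, ?_, ?_, ?_, ?_, h.iter_pos, ?_, ?_, ?_, ?_⟩
  · intro x ℓ hx
    by_cases hne : dijkstraLabel G w φ aux st u x = st.label x
    · exact h.walk x ℓ (hne ▸ hx)
    · obtain ⟨ℓ', h1, h2, -, -, h3⟩ := dijkstraLabel_changed hne
      obtain ⟨j, hj⟩ := h.walk u ℓ' h1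
      have : some ℓ = some _ := hx.symm.trans h3
      cases this
      exact ⟨_, SourceWalk.cons hj h2⟩
  · intro x hx
    rcases (hmemQ x).mp hx with h1 | h1
    · exact h.queue_mem x h1.2
    · exact h1.1
  · intro x hx
    by_cases hne : dijkstraLabel G w φ aux st u x = st.label x
    · rcases (hmemQ x).mp hx with h1 | h1
      · obtain ⟨ℓ, hℓ⟩ := h.queue_label x h1.2
        exact ⟨ℓ, hne.trans hℓ⟩
      · exact absurd hne h1.2
    · obtain ⟨ℓ', -, -, -, -, h3⟩ := dijkstraLabel_changed hne
      exact ⟨_, h3⟩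
  · intro x hx
    rcases List.mem_cons.mp hx with rfl | hx
    · exact h.queue_mem _ huQ
    · exact h.marked_mem x hx
  · intro x hx
    rcases List.mem_cons.mp hx with h1 | h1
    · exact ⟨ℓu, (hfix x hx).trans (h1 ▸ hℓu)⟩
    · obtain ⟨ℓ, hℓ⟩ := h.marked_label x h1
      exact ⟨ℓ, (hfix x hx).trans hℓ⟩
  · intro x ℓ y hx hxQ he hw
    obtain ⟨h1, h2⟩ := hnot x hxQ
    have hx' : st.label x = some ℓ := h2.symm.trans hx
    rcases h1 with rfl | h1
    · exact labelLE_relax_of_edge (sel := fun e => 0 ≤ reweight w φ e) hx' he hw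
    · exact hmono (h.dijkstra x ℓ y hx' h1 he hw)
  · intro x ℓ y hx hxQ hxm he hw
    obtain ⟨h1, h2⟩ := hnot x hxQ
    have hx' : st.label x = some ℓ := h2.symm.trans hx
    have hxm' := List.not_mem_of_not_mem_cons hxm
    rcases h1 with rfl | h1
    · exact absurd List.mem_cons_self hxm
    · exact hmono (h.ford x ℓ y hx' h1 hxm' he hw)
  · exact fun j x ℓ hj hi => hmono (h.progress j x ℓ hj hi)
  · exact fun j v ℓ x hj hi he hw => hmono (h.progress_neg j v ℓ x hj hi he hw)
  · exact hmono h.source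
  · intro m hm x hx
    have hkey : st.dist m - φ m ≤ st.dist u - φ u := by
      rcases List.mem_cons.mp hm with rfl | hm
      · exact le_rfl
      · exact h.sep m hm u huQ
    have hdm : (extractState G w φ aux st u).dist m = st.dist m := by
      simp only [BFDState.dist]
      rw [hfix m hm]
    rw [hdm]
    refine hkey.trans ?_
    by_cases hne : dijkstraLabel G w φ aux st u x = st.label x
    · have hdx : (extractState G w φ aux st u).dist x = st.dist x := by
        simp only [BFDState.dist]
        rw [hne]
      rw [hdx]
      rcases (hmemQ x).mp hx with h1 | h1
      · exact hmin x h1.2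
      · exact absurd hne h1.2
    · obtain ⟨ℓ', h1, -, h2, -, h3⟩ := dijkstraLabel_changed hne
      rw [BFDState.dist_eq h1, BFDState.dist_eq (st := extractState G w φ aux st u) h3]
      simp only [reweight] at h2 ⊢
      linarith
  · intro m hm hmQ
    rcases (hmemQ m).mp hmQ with h1 | h1
    · rcases List.mem_cons.mp hm with h2 | h2
      · exact h1.1 h2
      · exact h.disj m h2 h1.2
    · exact h1.2 (hfix m hm)
  · exact List.nodup_cons.mpr ⟨fun hum => h.disj u hum huQ, h.nodup⟩
  · exact Or.inr (List.cons_ne_nil _ _)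

/-- When Dijkstra's algorithm has emptied the queue in iteration `i`, the labels are at least as
good as all walks with fewer than `i` negative edges. -/
theorem BFDInv.progress_of_queue_empty {st : BFDState X} (h : BFDInv G w s φ aux st)
    (hQ : st.queue = ∅) {j : ℕ} {x : X} {ℓ : Label X} (hj : SourceWalk G w s φ aux j x ℓ)
    (hi : j + 1 ≤ st.iter) : LabelLE (st.label x) ℓ.dist := by
  induction hj with
  | nil => exact h.source
  | @cons j u ℓ x hj he ih =>
    split_ifs at hi with hw
    · exact h.progress_neg j u ℓ x hj (by omega) he hw
    · obtain ⟨ℓ', h1, h2⟩ := ih (by omega)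
      exact (h.dijkstra u ℓ' x h1 (by simp [hQ]) he (not_lt.mp hw)).mono (by simpa using h2)

theorem BFDInv.next (hG : WellFormed G s) {st : BFDState X} (h : BFDInv G w s φ aux st)
    (hQ : st.queue = ∅) (hne : ∃ x ∈ G.verts, fordLabel G w φ aux st x ≠ st.label x) :
    BFDInv G w s φ aux (nextState G w φ aux st) := by
  have hmemQ : ∀ x, x ∈ (nextState G w φ aux st).queue ↔
      x ∈ G.verts ∧ fordLabel G w φ aux st x ≠ st.label x := by
    intro x
    simp
  have hnot : ∀ x, x ∉ (nextState G w φ aux st).queue →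
      fordLabel G w φ aux st x = st.label x := by
    intro x hx
    by_contra hne
    obtain ⟨u, -, ℓ, -, h2, -⟩ := fordLabel_changed hne
    exact hx ((hmemQ x).mpr ⟨hG.snd_mem h2, hne⟩)
  have hford : ∀ x ℓ y, st.label x = some ℓ → (x, y) ∈ G.edges → reweight w φ (x, y) < 0 →
      LabelLE (fordLabel G w φ aux st y) (ℓ.dist + w (x, y)) := by
    intro x ℓ y hx he hw
    by_cases hm : x ∈ st.marked
    · exact labelLE_relaxAll_of_edge hm hx he hw
    · exact LabelLE.relaxAll _ (h.ford x ℓ y hx (by simp [hQ]) hm he hw)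
  refine ⟨?_, ?_, ?_, ?_, ?_, ?_, ?_, ?_, ?_, LabelLE.relaxAll _ h.source, ?_, ?_, ?_, ?_, ?_⟩
  · intro x ℓ hx
    by_cases hne : fordLabel G w φ aux st x = st.label x
    · exact h.walk x ℓ (hne ▸ hx)
    · obtain ⟨u, -, ℓ', h1, h2, -, -, h3⟩ := fordLabel_changed hne
      obtain ⟨j, hj⟩ := h.walk u ℓ' h1
      have : some ℓ = some _ := hx.symm.trans h3
      cases this
      exact ⟨_, SourceWalk.cons hj h2⟩
  · exact fun x hx => ((hmemQ x).mp hx).1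
  · intro x hx
    obtain ⟨u, -, ℓ', -, -, -, -, h3⟩ := fordLabel_changed ((hmemQ x).mp hx).2
    exact ⟨_, h3⟩
  · exact fun x hx => absurd hx List.not_mem_nil
  · exact fun x hx => absurd hx List.not_mem_nil
  · intro x ℓ y hx hxQ he hw
    have hx' : st.label x = some ℓ := (hnot x hxQ).symm.trans hx
    exact LabelLE.relaxAll _ (h.dijkstra x ℓ y hx' (by simp [hQ]) he hw)
  · intro x ℓ y hx hxQ _ he hw
    exact hford x ℓ y ((hnot x hxQ).symm.trans hx) he hw
  · exact fun j x ℓ hj hi =>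
      LabelLE.relaxAll _ (h.progress_of_queue_empty hQ hj (Nat.lt_succ_iff.mp hi))
  · intro j u ℓ x hj hi he hw
    obtain ⟨ℓ', h1, h2⟩ := h.progress_of_queue_empty hQ hj (Nat.lt_succ_iff.mp hi)
    exact (hford u ℓ' x h1 he hw).mono (by linarith)
  · exact Nat.le_add_left _ _
  · exact fun x hx => absurd hx List.not_mem_nil
  · exact fun x hx => absurd hx List.not_mem_nil
  · exact List.nodup_nil
  · obtain ⟨x, hx⟩ := hne
    exact Or.inl ⟨x, (hmemQ x).mpr hx⟩

theorem BFDInv.withStatus {st : BFDState X} (h : BFDInv G w s φ aux st) (σ : Status) :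
    BFDInv G w s φ aux { st with status := σ } :=
  ⟨h.walk, h.queue_mem, h.queue_label, h.marked_mem, h.marked_label, h.dijkstra, h.ford,
    h.progress, h.progress_neg, h.source, h.iter_pos, h.sep, h.disj, h.nodup, h.nonempty⟩

theorem BFDInv.step (hG : WellFormed G s) {st st' : BFDState X} {τ : ℝ}
    (h : BFDInv G w s φ aux st) (hst : BFDStep G w s φ aux d st st' τ) :
    BFDInv G w s φ aux st' := by
  cases hst with
  | halted => exact h
  | extract u hQ _ hu => exact h.extract hG hQ hu
  | abort => exact h.withStatus _
  | next _ hQ _ hne => exact h.next hG hQ hne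
  | finish => exact h.withStatus _

theorem bfdInv_run (hG : WellFormed G s) (t : ℕ) :
    BFDInv G w s φ aux (bfdRun G w s φ aux d t) :=
  bfdRun_induction (bfdInv_init hG) (fun _ _ _ h hst => h.step hG hst) t

/-! ### Number of iterations, and running time -/

/-- A vertex takes part only in the first `K + 1` iterations, if one of the shortest walks to it has
`K` negative edges: afterwards its label is final. -/
theorem iter_le_of_mem_marked (hG : WellFormed G s) {K : ℕ} {v : X} {ℓv : Label X}
    (hK : SourceWalk G w s φ aux K v ℓv)
    (hmin : ∀ j ℓ, SourceWalk G w s φ aux j v ℓ → ℓv.dist ≤ ℓ.dist) (t : ℕ)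
    (hv : v ∈ (bfdRun G w s φ aux d t).marked) : (bfdRun G w s φ aux d t).iter ≤ K + 1 := by
  have key : BFDInv G w s φ aux (bfdRun G w s φ aux d t) ∧
      (v ∈ (bfdRun G w s φ aux d t).queue ∨ v ∈ (bfdRun G w s φ aux d t).marked →
        (bfdRun G w s φ aux d t).iter ≤ K + 1) := by
    refine bfdRun_induction (P := fun st => BFDInv G w s φ aux st ∧
      (v ∈ st.queue ∨ v ∈ st.marked → st.iter ≤ K + 1)) ⟨bfdInv_init hG, fun _ => ?_⟩ ?_ t
    · exact Nat.le_add_left _ _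
    · rintro st st' τ ⟨hinv, hle⟩ hst
      refine ⟨hinv.step hG hst, ?_⟩
      cases hst with
      | halted => exact hle
      | extract u hQ _ hu =>
        intro hvm
        have huQ : u ∈ st.queue := hu ▸ extractMin_mem hQ
        by_contra hi
        have hi' : K + 1 < st.iter := not_le.mp hi
        have hno : v ∉ st.queue ∧ v ∉ st.marked := by
          constructor <;> intro h' <;> exact absurd (hle (by simp [h'])) hi
        obtain ⟨ℓ₀, h1, h2⟩ := hinv.progress K v ℓv hK hi'
        rcases hvm with hvm | hvm
        · simp only [Finset.mem_union, Finset.mem_erase, Finset.mem_filter] at hvm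
          rcases hvm with h3 | h3
          · exact hno.1 h3.2
          · obtain ⟨ℓ', h4, h5, -, h6, -⟩ := dijkstraLabel_changed h3.2
            obtain ⟨j, hj⟩ := hinv.walk u ℓ' h4
            have h7 := hmin _ _ (SourceWalk.cons hj h5)
            have h8 := h6 ℓ₀ h1
            linarith
        · rcases List.mem_cons.mp hvm with rfl | h3
          · exact hno.1 huQ
          · exact hno.2 h3
      | abort => exact hle
      | next _ hQ _ hne =>
        intro hvm
        by_contra hi
        have hi' : K + 1 ≤ st.iter := Nat.lt_succ_iff.mp (not_le.mp hi)
        obtain ⟨ℓ₀, h1, h2⟩ := hinv.progress_of_queue_empty hQ hK hi'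
        rcases hvm with hvm | hvm
        · obtain ⟨u, -, ℓ', h4, h5, -, h6, -⟩ := fordLabel_changed (Finset.mem_filter.mp hvm).2
          obtain ⟨j, hj⟩ := hinv.walk u ℓ' h4
          have h7 := hmin _ _ (SourceWalk.cons hj h5)
          have h8 := h6 ℓ₀ h1
          linarith
        · exact absurd hvm List.not_mem_nil
      | finish => exact hle
  exact key.2 (Or.inr hv)

/-- If the negative edges out of the vertices extracted in an iteration improve no label, then all
edges out of labelled vertices are relaxed. -/
theorem BFDInv.relaxed_of_fordLabel_eq (hG : WellFormed G s) {st : BFDState X}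
    (h : BFDInv G w s φ aux st) (hQ : st.queue = ∅)
    (hfix : ∀ x ∈ G.verts, fordLabel G w φ aux st x = st.label x) {x y : X} {ℓ : Label X}
    (hx : st.label x = some ℓ) (he : (x, y) ∈ G.edges) :
    LabelLE (st.label y) (ℓ.dist + w (x, y)) := by
  have hxQ : x ∉ st.queue := by simp [hQ]
  rcases le_or_gt 0 (reweight w φ (x, y)) with hw | hw
  · exact h.dijkstra x ℓ y hx hxQ he hw
  · by_cases hm : x ∈ st.marked
    · rw [← hfix y (hG.snd_mem he)]
      exact labelLE_relaxAll_of_edge hm hx he hw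
    · exact h.ford x ℓ y hx hxQ hm he hw

/-- If a walk with `K` negative edges is as short as any walk to `z`, and all such walks to `z` have
auxiliary weight more than `d`, then there are at most `K + 1` iterations, and the run does not come
to its regular end. -/
theorem iter_le_and_not_finished (hG : WellFormed G s) {K : ℕ} {z : X} {ℓz : Label X}
    (hz : z ∈ G.verts) (hK : SourceWalk G w s φ aux K z ℓz)
    (hlong : ∀ j ℓ, SourceWalk G w s φ aux j z ℓ → ℓ.dist ≤ ℓz.dist → d < ℓ.aux) (t : ℕ) :
    (bfdRun G w s φ aux d t).iter ≤ K + 1 ∧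
      (bfdRun G w s φ aux d t).status ≠ Status.finished := by
  have key : BFDInv G w s φ aux (bfdRun G w s φ aux d t) ∧
      (bfdRun G w s φ aux d t).iter ≤ K + 1 ∧
      (bfdRun G w s φ aux d t).status ≠ Status.finished := by
    refine bfdRun_induction (P := fun st => BFDInv G w s φ aux st ∧ st.iter ≤ K + 1 ∧
      st.status ≠ Status.finished) ⟨bfdInv_init hG, Nat.le_add_left _ _, by simp [bfdInit]⟩ ?_ t
    rintro st st' τ ⟨hinv, hle, hnf⟩ hst
    have hbad : st.queue = ∅ → LabelLE (st.label z) ℓz.dist →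
        (∀ x ∈ G.verts, ∀ ℓ, st.label x = some ℓ → ℓ.aux ≤ d) → False := by
      intro _ hlab haux
      obtain ⟨ℓ₀, h1, h2⟩ := hlab
      obtain ⟨j, hj⟩ := hinv.walk z ℓ₀ h1
      exact absurd (haux z hz ℓ₀ h1) (not_le.mpr (hlong j ℓ₀ hj h2))
    refine ⟨hinv.step hG hst, ?_⟩
    cases hst with
    | halted => exact ⟨hle, hnf⟩
    | extract u hQ hr hu => exact ⟨hle, hnf⟩
    | abort => exact ⟨hle, by simp⟩
    | next _ hQ haux hne =>
      refine ⟨?_, by simp⟩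
      by_contra hi
      have hi' : K + 1 ≤ st.iter := Nat.lt_succ_iff.mp (not_le.mp hi)
      exact hbad hQ (hinv.progress_of_queue_empty hQ hK hi') haux
    | finish _ hQ haux hfix =>
      exfalso
      refine hbad hQ ?_ haux
      clear hlong hz hbad hle
      induction hK with
      | nil => exact hinv.source
      | @cons j u ℓ x hj he ih =>
        obtain ⟨ℓ', h1, h2⟩ := ih
        exact (hinv.relaxed_of_fordLabel_eq hG hQ hfix h1 he).mono (by simpa using h2)
  exact key.2

/-- A halted run that has not come to its regular end has recorded a walk of auxiliary weight more
than `d`; at the regular end, all edges are relaxed. -/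
theorem bfdRun_halted (hG : WellFormed G s) (t : ℕ) :
    ((bfdRun G w s φ aux d t).status = Status.aborted → (bfdRun G w s φ aux d t).queue = ∅ ∧
      ∃ x ∈ G.verts, ∃ ℓ, (bfdRun G w s φ aux d t).label x = some ℓ ∧ d < ℓ.aux) ∧
    ((bfdRun G w s φ aux d t).status = Status.finished →
      ∀ x y ℓ, (bfdRun G w s φ aux d t).label x = some ℓ → (x, y) ∈ G.edges →
        LabelLE ((bfdRun G w s φ aux d t).label y) (ℓ.dist + w (x, y))) := by
  refine (bfdRun_induction (P := fun st => BFDInv G w s φ aux st ∧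
    ((st.status = Status.aborted → st.queue = ∅ ∧
      ∃ x ∈ G.verts, ∃ ℓ, st.label x = some ℓ ∧ d < ℓ.aux) ∧
    (st.status = Status.finished → ∀ x y ℓ, st.label x = some ℓ → (x, y) ∈ G.edges →
      LabelLE (st.label y) (ℓ.dist + w (x, y)))))
    ⟨bfdInv_init hG, by simp [bfdInit], by simp [bfdInit]⟩ ?_ t).2
  rintro st st' τ ⟨hinv, hP⟩ hst
  refine ⟨hinv.step hG hst, ?_⟩
  cases hst with
  | halted => exact hP
  | extract u hQ hr hu => exact ⟨by simp [hr], by simp [hr]⟩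
  | abort _ hQ hx => exact ⟨fun _ => ⟨hQ, hx⟩, by simp⟩
  | next => exact ⟨by simp, by simp⟩
  | finish _ hQ _ hfix =>
    exact ⟨by simp, fun _ x y ℓ hx he => hinv.relaxed_of_fordLabel_eq hG hQ hfix hx he⟩

theorem lglg_nonneg (n : ℕ) : 0 ≤ lglg n := zero_le_one.trans (le_max_left _ _)

/-- The time charged to each extraction of `u`: the extraction itself, the later relaxation of
its negative edges, and the constant overhead of an iteration. -/
def extractCost (G : DGraph X) (u : X) : ℝ := lglg G.verts.card + 3 + 2 * outdeg G u

theorem extractCost_nonneg (G : DGraph X) (u : X) : 0 ≤ extractCost G u := by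
  have := lglg_nonneg G.verts.card
  unfold extractCost
  positivity

/-- If every vertex `v` takes part in the first `B v` iterations only, the time spent in the first
`T` steps is at most `∑ v, B v * extractCost v`, since a vertex is extracted at most once per
iteration. -/
theorem sum_bfdStepTime_le (hG : WellFormed G s) {B : X → ℕ}
    (hB : ∀ t, ∀ v ∈ (bfdRun G w s φ aux d t).marked, (bfdRun G w s φ aux d t).iter ≤ B v)
    (T : ℕ) :
    ∑ t ∈ Finset.range T, bfdStepTime G s φ (bfdRun G w s φ aux d t) ≤
      ∑ v ∈ G.verts, (B v : ℝ) * extractCost G v := by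
  -- number of extractions of `v` that the state `st` allows for
  let used : BFDState X → X → ℕ := fun st v =>
    min (st.iter - 1) (B v) + if v ∈ st.marked then 1 else 0
  -- cost of the end of the current iteration, which is charged in advance
  let debt : BFDState X → ℝ := fun st =>
    if st.status = Status.running then (if st.marked = [] then 0 else 1) +
      (st.marked.map (fun u => 1 + (outdeg G u : ℝ))).sum else 0
  have hdebt : ∀ st, 0 ≤ debt st := by
    intro st
    have h1 : 0 ≤ (st.marked.map (fun u => 1 + (outdeg G u : ℝ))).sum :=
      List.sum_nonneg (by simp only [List.mem_map]; rintro _ ⟨u, -, rfl⟩; positivity)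
    simp only [debt]
    split_ifs <;> linarith
  have hused : ∀ t, ∀ v ∈ G.verts, used (bfdRun G w s φ aux d t) v ≤ B v := by
    intro t v _
    have h1 := (bfdInv_run (w := w) (φ := φ) (aux := aux) (d := d) hG t).iter_pos
    simp only [used]
    split_ifs with hm
    · have := hB t v hm
      omega
    · omega
  have main : ∀ T, ∑ t ∈ Finset.range T, bfdStepTime G s φ (bfdRun G w s φ aux d t) +
      debt (bfdRun G w s φ aux d T) ≤
      ∑ v ∈ G.verts, (used (bfdRun G w s φ aux d T) v : ℝ) * extractCost G v := by
    intro T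
    induction T with
    | zero => simp [bfdRun, bfdInit, debt, used]
    | succ T ih =>
      have hinv := bfdInv_run (w := w) (φ := φ) (aux := aux) (d := d) hG T
      have hstep := bfdStep_spec G w s φ aux d (bfdRun G w s φ aux d T)
      rw [← bfdRun_succ] at hstep
      rw [Finset.sum_range_succ]
      have hBT := hB T
      generalize bfdStepTime G s φ (bfdRun G w s φ aux d T) = τ at hstep ⊢
      generalize bfdRun G w s φ aux d (T + 1) = st' at hstep ⊢
      generalize bfdRun G w s φ aux d T = st at *
      have hend : st.status = Status.running → st.queue = ∅ →
          debt st = 1 + (st.marked.map (fun u => 1 + (outdeg G u : ℝ))).sum := by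
        intro hr hQ
        have : st.marked ≠ [] := hinv.nonempty.resolve_left (by simp [hQ])
        simp [debt, hr, this]
      cases hstep with
      | halted => linarith
      | extract u hQ hr hu =>
        have huQ : u ∈ st.queue := hu ▸ extractMin_mem hQ
        have hum : u ∉ st.marked := fun h => hinv.disj u h huQ
        have h1 : ∀ v, (used (extractState G w φ aux st u) v : ℝ) =
            used st v + if v = u then 1 else 0 := by
          intro v
          by_cases hv : v = u
          · subst hv
            simp [used, hum]
          · simp [used, hv]
        have h2 : debt (extractState G w φ aux st u) ≤ debt st + (1 + (1 + outdeg G u)) := by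
          simp only [debt, hr, if_true, List.map_cons, List.sum_cons, List.cons_ne_nil, if_false]
          split_ifs <;> linarith
        have h3 : ∑ v ∈ G.verts, (used (extractState G w φ aux st u) v : ℝ) * extractCost G v =
            ∑ v ∈ G.verts, (used st v : ℝ) * extractCost G v + extractCost G u := by
          simp only [h1, add_mul, Finset.sum_add_distrib, ite_mul, one_mul, zero_mul]
          rw [Finset.sum_ite_eq' G.verts u, if_pos (hinv.queue_mem u huQ)]
        rw [h3]
        unfold extractCost
        unfold extractCost at ih
        linarith
      | abort hr hQ =>
        rw [hend hr hQ] at ih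
        simpa [debt, used] using ih
      | finish hr hQ =>
        rw [hend hr hQ] at ih
        simpa [debt, used] using ih
      | next hr hQ =>
        rw [hend hr hQ] at ih
        have h1 : debt (nextState G w φ aux st) = 0 := by simp [debt]
        rw [h1, add_zero]
        refine ih.trans (Finset.sum_le_sum fun v _ => ?_)
        refine mul_le_mul_of_nonneg_right ?_ (extractCost_nonneg G v)
        have hpos := hinv.iter_pos
        have h2 : used st v ≤ used (nextState G w φ aux st) v := by
          simp only [used, List.not_mem_nil, if_false, add_zero, Nat.add_sub_cancel]
          split_ifs with hm
          · have := hBT v hm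
            omega
          · omega
        exact_mod_cast h2
  refine le_trans ?_ ((main T).trans (Finset.sum_le_sum fun v hv =>
    mul_le_mul_of_nonneg_right (by exact_mod_cast hused T v hv) (extractCost_nonneg G v)))
  linarith [hdebt (bfdRun G w s φ aux d T)]

/-- A running step takes time at least `1`. -/
theorem one_le_bfdStepTime {st : BFDState X} (h : st.status = Status.running) :
    1 ≤ bfdStepTime G s φ st := by
  unfold bfdStepTime
  simp only [h]
  split_ifs with hQ
  · have := lglg_nonneg G.verts.card
    have : (0 : ℝ) ≤ outdeg G (extractMin (fun x => st.dist x + φ s - φ x) st.queue hQ) :=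
      Nat.cast_nonneg _
    linarith
  · have : 0 ≤ (st.marked.map (fun u => 1 + (outdeg G u : ℝ))).sum :=
      List.sum_nonneg (by simp only [List.mem_map]; rintro _ ⟨u, -, rfl⟩; positivity)
    linarith

/-- The run halts if every vertex takes part in a bounded number of iterations only. -/
theorem exists_halted (hG : WellFormed G s) {B : X → ℕ}
    (hB : ∀ t, ∀ v ∈ (bfdRun G w s φ aux d t).marked, (bfdRun G w s φ aux d t).iter ≤ B v) :
    ∃ t, (bfdRun G w s φ aux d t).status ≠ Status.running := by
  by_contra! h
  obtain ⟨T, hT⟩ := exists_nat_gt (∑ v ∈ G.verts, (B v : ℝ) * extractCost G v)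
  have h1 := sum_bfdStepTime_le hG hB T
  have h2 : ∑ t ∈ Finset.range T, (1 : ℝ) ≤
      ∑ t ∈ Finset.range T, bfdStepTime G s φ (bfdRun G w s φ aux d t) :=
    Finset.sum_le_sum fun t _ => one_le_bfdStepTime (h t)
  simp at h2
  linarith

end BFDAnalysis

/-! ### Paths -/

section Paths

variable {X : Type*} {H : DGraph X} {w : X × X → ℝ} {φ : X → ℝ} {d : ℝ}

@[simp] theorem walkEdges_singleton (v : X) : walkEdges [v] = [] := rfl

@[simp] theorem walkEdges_cons_cons (a b : X) (l : List X) :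
    walkEdges (a :: b :: l) = (a, b) :: walkEdges (b :: l) := rfl

theorem walkEdges_append_cons (l₁ : List X) (a : X) (l₂ : List X) :
    walkEdges (l₁ ++ a :: l₂) = walkEdges (l₁ ++ [a]) ++ walkEdges (a :: l₂) := by
  induction l₁ with
  | nil => simp
  | cons b l ih =>
    cases l with
    | nil => simp
    | cons c l => simpa using ih

theorem walkEdges_snoc {p : List X} {u : X} (h : p.getLast? = some u) (v : X) :
    walkEdges (p ++ [v]) = walkEdges p ++ [(u, v)] := by
  obtain ⟨q, rfl⟩ := List.getLast?_eq_some_iff.mp h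
  rw [List.append_assoc, List.singleton_append, walkEdges_append_cons]
  rfl

theorem pathWeight_append_cons (w : X × X → ℝ) (l₁ : List X) (a : X) (l₂ : List X) :
    pathWeight w (l₁ ++ a :: l₂) = pathWeight w (l₁ ++ [a]) + pathWeight w (a :: l₂) := by
  simp only [pathWeight]
  rw [walkEdges_append_cons, List.map_append, List.sum_append]

@[simp] theorem pathWeight_singleton (w : X × X → ℝ) (v : X) : pathWeight w [v] = 0 := rfl

theorem pathWeight_snoc (w : X × X → ℝ) {p : List X} {u : X} (h : p.getLast? = some u) (v : X) :
    pathWeight w (p ++ [v]) = pathWeight w p + w (u, v) := by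
  simp [pathWeight, walkEdges_snoc h]

theorem negCount_snoc (w : X × X → ℝ) {p : List X} {u : X} (h : p.getLast? = some u) (v : X) :
    negCount w (p ++ [v]) = negCount w p + if w (u, v) < 0 then 1 else 0 := by
  simp [negCount, walkEdges_snoc h, List.countP_cons]

theorem isPathTo_singleton {v : X} (hv : v ∈ H.verts) : IsPathTo H [v] v :=
  ⟨⟨by simp, by simpa using hv, by simp⟩, rfl⟩

theorem IsPathTo.mem_verts {p : List X} {v : X} (h : IsPathTo H p v) : v ∈ H.verts :=
  h.1.2.1 v (List.mem_of_getLast? h.2)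

theorem IsPathTo.snoc {p : List X} {u v : X} (h : IsPathTo H p u) (he : (u, v) ∈ H.edges)
    (hv : v ∈ H.verts) : IsPathTo H (p ++ [v]) v := by
  refine ⟨⟨by simp, ?_, ?_⟩, by simp⟩
  · intro x hx
    rcases List.mem_append.mp hx with hx | hx
    · exact h.1.2.1 x hx
    · rwa [List.mem_singleton.mp hx]
  · refine List.isChain_append.mpr ⟨h.1.2.2, by simp, ?_⟩
    intro x hx y hy
    have h1 : x = u := by
      rw [h.2] at hx
      exact (Option.mem_some_iff.mp hx).symm
    have h2 : y = v := by simpa using hy.symm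
    rwa [h1, h2]

/-- A path is empty, or a path with one more edge at its end. -/
theorem IsPathTo.cases_snoc {p : List X} {v : X} (h : IsPathTo H p v) :
    p = [v] ∨ ∃ q u, p = q ++ [v] ∧ IsPathTo H q u ∧ (u, v) ∈ H.edges := by
  obtain ⟨q, rfl⟩ := List.getLast?_eq_some_iff.mp h.2
  rcases List.eq_nil_or_concat q with rfl | ⟨r, u, rfl⟩
  · exact Or.inl rfl
  · refine Or.inr ⟨r ++ [u], u, by simp, ⟨⟨by simp, ?_, ?_⟩, by simp⟩, ?_⟩
    · intro x hx
      exact h.1.2.1 x (by simp at hx ⊢; tauto)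
    · have := List.isChain_append.mp h.1.2.2
      simpa using this.1
    · have := List.isChain_append.mp h.1.2.2
      exact this.2.2 u (by simp) v (by simp)

theorem IsPathTo.mem_edges {p : List X} {v : X} (h : IsPathTo H p v) :
    ∀ e ∈ walkEdges p, e ∈ H.edges := by
  have : ∀ p : List X, p.IsChain (fun a b => (a, b) ∈ H.edges) → ∀ e ∈ walkEdges p, e ∈ H.edges := by
    intro p
    induction p with
    | nil => simp [walkEdges]
    | cons a l ih =>
      cases l with
      | nil => simp
      | cons b l =>
        intro hc e he
        rw [List.isChain_cons_cons] at hc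
        rcases List.mem_cons.mp he with rfl | he
        · exact hc.1
        · exact ih hc.2 e he
  exact this p h.1.2.2

theorem IsShortestPathTo.prefix {q : List X} {u v : X} (hq : IsPathTo H q u)
    (he : (u, v) ∈ H.edges) (h : IsShortestPathTo H w (q ++ [v]) v) : IsShortestPathTo H w q u := by
  refine ⟨hq, fun r hr => ?_⟩
  have := h.2 _ (hr.snoc he h.1.mem_verts)
  rw [pathWeight_snoc w hq.2, pathWeight_snoc w hr.2] at this
  linarith

theorem IsShortestPathTo.snoc {q r : List X} {u v : X} (hr : IsShortestPathTo H w r u)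
    (hq : IsPathTo H q u) (he : (u, v) ∈ H.edges) (h : IsShortestPathTo H w (q ++ [v]) v) :
    IsShortestPathTo H w (r ++ [v]) v := by
  refine ⟨hr.1.snoc he h.1.mem_verts, fun p hp => (le_trans ?_ (h.2 p hp))⟩
  rw [pathWeight_snoc w hq.2, pathWeight_snoc w hr.1.2]
  linarith [hr.2 q hq]

/-- Cycles can be removed from a path. -/
theorem NoNegCycle.exists_nodup (hH : NoNegCycle H w) {p : List X} {v : X} (hp : IsPathTo H p v) :
    ∃ q, IsPathTo H q v ∧ q.Nodup ∧ pathWeight w q ≤ pathWeight w p := by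
  induction hn : p.length using Nat.strong_induction_on generalizing p with
  | _ n ih =>
    by_cases hnd : p.Nodup
    · exact ⟨p, hp, hnd, le_rfl⟩
    · obtain ⟨a, ha⟩ : ∃ a, List.Duplicate a p := by
        by_contra! h
        exact hnd (List.nodup_iff_forall_not_duplicate.mpr h)
      obtain ⟨l₁, m, rfl, h1, h2⟩ := List.cons_sublist_iff.mp (List.duplicate_iff_sublist.mp ha)
      obtain ⟨l₁, b, rfl⟩ := List.append_of_mem h1
      obtain ⟨c, l₃, rfl⟩ := List.append_of_mem (List.singleton_sublist.mp h2)
      have e : l₁ ++ a :: b ++ (c ++ a :: l₃) = l₁ ++ a :: ((b ++ c) ++ a :: l₃) := by simp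
      rw [e] at hp hn ⊢
      generalize b ++ c = l₂ at hp hn
      obtain ⟨⟨-, hv, hc⟩, hl⟩ := hp
      have hcyc : IsPath H (a :: (l₂ ++ [a])) := by
        refine ⟨by simp, fun x hx => hv x (by simp at hx ⊢; tauto), ?_⟩
        refine hc.infix ⟨l₁, l₃, by simp⟩
      have hnew : IsPathTo H (l₁ ++ a :: l₃) v := by
        refine ⟨⟨by simp, fun x hx => hv x (by simp at hx ⊢; tauto), ?_⟩, ?_⟩
        · have h3 : (l₁ ++ [a]).IsChain (fun a b => (a, b) ∈ H.edges) :=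
            hc.infix ⟨[], l₂ ++ a :: l₃, by simp⟩
          have h4 : (a :: l₃).IsChain (fun a b => (a, b) ∈ H.edges) :=
            hc.infix ⟨l₁ ++ a :: l₂, [], by simp⟩
          rw [List.isChain_append] at h3 ⊢
          exact ⟨h3.1, h4, by simpa using h3.2.2⟩
        · rw [← hl]
          cases l₃ <;> simp [List.getLast?_append, List.getLast?_cons]
      obtain ⟨q, hq1, hq2, hq3⟩ := ih _ (by rw [← hn]; simp) hnew rfl
      refine ⟨q, hq1, hq2, hq3.trans ?_⟩
      have h5 := hH _ hcyc (by simp [List.getLast?_cons])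
      have e2 : a :: (l₂ ++ a :: l₃) = (a :: l₂) ++ a :: l₃ := rfl
      rw [pathWeight_append_cons w l₁ a l₃, pathWeight_append_cons w l₁ a (l₂ ++ a :: l₃), e2,
        pathWeight_append_cons w (a :: l₂) a l₃]
      have e3 : (a :: l₂) ++ [a] = a :: (l₂ ++ [a]) := rfl
      rw [e3]
      linarith

theorem NoNegCycle.exists_isShortestPathTo [Finite X] (hH : NoNegCycle H w) {v : X}
    (hv : v ∈ H.verts) : ∃ p, IsShortestPathTo H w p v := by
  have := Fintype.ofFinite X
  have hfin : {q : List X | IsPathTo H q v ∧ q.Nodup}.Finite :=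
    (List.finite_length_le X (Fintype.card X)).subset fun q hq => hq.2.length_le_card
  obtain ⟨p, hp, hmin⟩ := Set.exists_min_image _ (pathWeight w) hfin
    ⟨[v], isPathTo_singleton hv, List.nodup_singleton v⟩
  refine ⟨p, hp.1, fun q hq => ?_⟩
  obtain ⟨r, hr1, hr2, hr3⟩ := hH.exists_nodup hq
  exact (hmin r ⟨hr1, hr2⟩).trans hr3

/-- If all shortest paths to some vertex are long in `H_{≥ 0}`, then so are all shortest paths to some
vertex `z` with a shortest path of the form `q ++ [z]`, where `q` is not long. -/
theorem exists_critical_edge (hd : 0 ≤ d) {p : List X} {v : X} (hp : IsShortestPathTo H w p v)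
    (hv : ∀ q, IsShortestPathTo H w q v → d < pathWeight (nonnegPart w) q) :
    ∃ q y z, IsPathTo H q y ∧ pathWeight (nonnegPart w) q ≤ d ∧
      IsShortestPathTo H w (q ++ [z]) z ∧
      ∀ r, IsShortestPathTo H w r z → d < pathWeight (nonnegPart w) r := by
  induction hn : p.length generalizing p v with
  | zero => exact absurd (List.length_eq_zero_iff.mp hn) hp.1.1.1
  | succ n ih =>
    rcases hp.1.cases_snoc with rfl | ⟨q, u, rfl, hq, he⟩
    · exact absurd (hv _ hp) (by simpa using hd)
    · by_cases hu : ∃ r, IsShortestPathTo H w r u ∧ pathWeight (nonnegPart w) r ≤ d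
      · obtain ⟨r, hr, hrd⟩ := hu
        exact ⟨r, u, v, hr.1, hrd, hr.snoc hq he hp, hv⟩
      · push Not at hu
        exact ih (hp.prefix hq he) hu (by simpa using hn)

/-! ### Source walks of `H_s` are paths of `H` -/

/-- The endpoints of all edges of `H` are vertices of `H`. -/
def EdgesInVerts (H : DGraph X) : Prop := ∀ e ∈ H.edges, e.1 ∈ H.verts ∧ e.2 ∈ H.verts

theorem mem_addSource_edges_some {u v : X} :
    (some u, some v) ∈ (addSource H).edges ↔ (u, v) ∈ H.edges := by
  simp [addSource]

theorem mem_addSource_edges_none {v : X} :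
    (none, some v) ∈ (addSource H).edges ↔ v ∈ H.verts := by
  simp [addSource]

theorem not_mem_addSource_edges {x : Option X} : (x, none) ∉ (addSource H).edges := by
  simp [addSource]

theorem mem_addSource_verts_some {v : X} : some v ∈ (addSource H).verts ↔ v ∈ H.verts := by
  simp [addSource]

theorem wellFormed_addSource (hH : EdgesInVerts H) : WellFormed (addSource H) none where
  source_mem := by simp [addSource]
  fst_mem := by
    rintro ⟨_ | u, _ | v⟩ he
    · exact absurd he not_mem_addSource_edges
    · simp [addSource]
    · exact absurd he not_mem_addSource_edges
    · exact mem_addSource_verts_some.mpr (hH _ (mem_addSource_edges_some.mp he)).1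
  snd_mem := by
    rintro ⟨_ | u, _ | v⟩ he
    · exact absurd he not_mem_addSource_edges
    · exact mem_addSource_verts_some.mpr (mem_addSource_edges_none.mp he)
    · exact absurd he not_mem_addSource_edges
    · exact mem_addSource_verts_some.mpr (hH _ (mem_addSource_edges_some.mp he)).2

/-- The label of `P` as a path of `H_s`. -/
abbrev pathLabel (w aux : X × X → ℝ) (P : List X) : Label (Option X) :=
  ⟨pathWeight w P, pathWeight aux P, P.reverse.map some ++ [none]⟩

theorem IsPathTo.sourceWalk (aux : X × X → ℝ) (hφ : ∀ v ∈ H.verts, φ v ≤ 0) {P : List X} {v : X}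
    (hP : IsPathTo H P v) :
    SourceWalk (addSource H) (extendWeight w) none (extendPot φ) (extendWeight aux)
      (negCount (reweight w φ) P) (some v) (pathLabel w aux P) := by
  induction hn : P.length generalizing P v with
  | zero => exact absurd (List.length_eq_zero_iff.mp hn) hP.1.1
  | succ n ih =>
    rcases hP.cases_snoc with rfl | ⟨q, u, rfl, hq, he⟩
    · have h := SourceWalk.cons (SourceWalk.nil (G := addSource H) (w := extendWeight w) (s := none)
        (φ := extendPot φ) (aux := extendWeight aux))
        (mem_addSource_edges_none.mpr hP.mem_verts)
      have h1 : ¬ reweight (extendWeight w) (extendPot φ) (none, some v) < 0 := by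
        have := hφ v hP.mem_verts
        simp [reweight, extendWeight, extendPot, this]
      rw [if_neg h1] at h
      simpa [extendWeight, negCount, pathLabel] using h
    · have h := SourceWalk.cons (ih hq (by simpa using hn)) (mem_addSource_edges_some.mpr he)
      rw [negCount_snoc _ hq.2]
      have e : pathLabel w aux (q ++ [v]) = ⟨(pathLabel w aux q).dist + extendWeight w (some u, some v),
          (pathLabel w aux q).aux + extendWeight aux (some u, some v),
          some v :: (pathLabel w aux q).path⟩ := by
        simp [pathLabel, pathWeight_snoc _ hq.2, extendWeight]
      rw [e]
      exact h

theorem SourceWalk.exists_path {aux : X × X → ℝ} (hH : EdgesInVerts H) {j : ℕ} {x : Option X}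
    {ℓ : Label (Option X)}
    (h : SourceWalk (addSource H) (extendWeight w) none (extendPot φ) (extendWeight aux) j x ℓ) :
    (x = none ∧ ℓ = ⟨0, 0, [none]⟩) ∨
      ∃ v P, x = some v ∧ IsPathTo H P v ∧ ℓ = pathLabel w aux P := by
  induction h with
  | nil => exact Or.inl ⟨rfl, rfl⟩
  | @cons j u ℓ x hj he ih =>
    right
    cases x with
    | none => exact absurd he not_mem_addSource_edges
    | some v =>
      rcases ih with ⟨rfl, rfl⟩ | ⟨u, P, rfl, hP, rfl⟩
      · refine ⟨v, [v], rfl, isPathTo_singleton (mem_addSource_edges_none.mp he), ?_⟩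
        simp [extendWeight]
      · have he' := mem_addSource_edges_some.mp he
        refine ⟨v, P ++ [v], rfl, hP.snoc he' (hH _ he').2, ?_⟩
        simp [pathWeight_snoc _ hP.2, extendWeight]

theorem SourceWalk.exists_path_some {aux : X × X → ℝ} (hH : EdgesInVerts H) {j : ℕ} {v : X}
    {ℓ : Label (Option X)}
    (h : SourceWalk (addSource H) (extendWeight w) none (extendPot φ) (extendWeight aux) j
      (some v) ℓ) : ∃ P, IsPathTo H P v ∧ ℓ = pathLabel w aux P := by
  rcases h.exists_path hH with ⟨h1, -⟩ | ⟨v', P, h1, hP, h2⟩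
  · cases h1
  · cases h1
    exact ⟨P, hP, h2⟩

/-! ### Consequences for `BellmanFordDijkstra(H, φ)` -/

theorem run_iter_le_of_shortest (hH : EdgesInVerts H) (hφ : ∀ v ∈ H.verts, φ v ≤ 0) {p : List X}
    {v : X} (hp : IsShortestPathTo H w p v) (t : ℕ) (hv : some v ∈ (run H w φ d t).marked) :
    (run H w φ d t).iter ≤ negCount (reweight w φ) p + 1 := by
  refine iter_le_of_mem_marked (wellFormed_addSource hH)
    (hp.1.sourceWalk (nonnegPart w) hφ) ?_ t hv
  intro j ℓ hℓ
  obtain ⟨P, hP, rfl⟩ := hℓ.exists_path_some hH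
  exact hp.2 P hP

theorem run_iter_le_of_source (hH : EdgesInVerts H) (t : ℕ)
    (hv : none ∈ (run H w φ d t).marked) : (run H w φ d t).iter ≤ 1 := by
  refine iter_le_of_mem_marked (K := 0) (wellFormed_addSource hH) SourceWalk.nil ?_ t hv
  intro j ℓ hℓ
  rcases hℓ.exists_path hH with ⟨-, rfl⟩ | ⟨v, P, h, -⟩
  · exact le_rfl
  · cases h

/-- If a path `q` followed by the edge to `z` is a shortest path, and all shortest paths to `z` are
long in `H_{≥ 0}`, then the number of iterations is at most `2` plus the number of negative edges of
`q`, and the run does not come to its regular end. -/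
theorem run_iter_le_of_critical (hH : EdgesInVerts H) (hφ : ∀ v ∈ H.verts, φ v ≤ 0) {q : List X}
    {y z : X} (hq : IsPathTo H q y) (hz : IsShortestPathTo H w (q ++ [z]) z)
    (hlong : ∀ r, IsShortestPathTo H w r z → d < pathWeight (nonnegPart w) r) (t : ℕ) :
    (run H w φ d t).iter ≤ negCount (reweight w φ) q + 2 ∧
      (run H w φ d t).status ≠ Status.finished := by
  have h := iter_le_and_not_finished (d := d) (wellFormed_addSource hH)
    (mem_addSource_verts_some.mpr hz.1.mem_verts) (hz.1.sourceWalk (nonnegPart w) hφ)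
    (fun j ℓ hℓ hle => by
      obtain ⟨P, hP, rfl⟩ := hℓ.exists_path_some hH
      exact hlong P ⟨hP, fun r hr => le_trans hle (hz.2 r hr)⟩) t
  refine ⟨h.1.trans ?_, h.2⟩
  rw [negCount_snoc _ hq.2]
  split_ifs <;> omega

theorem findsLongPath_of_critical (hH : EdgesInVerts H) (hφ : ∀ v ∈ H.verts, φ v ≤ 0) (hd : 0 ≤ d)
    {q : List X} {y z : X} (hq : IsPathTo H q y) (hz : IsShortestPathTo H w (q ++ [z]) z)
    (hlong : ∀ r, IsShortestPathTo H w r z → d < pathWeight (nonnegPart w) r) :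
    FindsLongPath H w φ d := by
  have hG := wellFormed_addSource hH
  have hiter := run_iter_le_of_critical hH hφ hq hz hlong
  obtain ⟨t, ht⟩ := exists_halted (w := extendWeight w) (φ := extendPot φ)
    (aux := extendWeight (nonnegPart w)) (d := d) hG
    (B := fun _ => negCount (reweight w φ) q + 2) (fun t v _ => (hiter t).1)
  have hab : (run H w φ d t).status = Status.aborted := by
    have h2 := (hiter t).2
    change (run H w φ d t).status ≠ Status.running at ht
    cases h : (run H w φ d t).status with
    | running => exact absurd h ht
    | finished => exact absurd h h2
    | aborted => rfl
  refine ⟨t, hab, ?_⟩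
  obtain ⟨hQ, x, hx, ℓ, hℓ, hdℓ⟩ := (bfdRun_halted hG t).1 hab
  have hinv := bfdInv_run (w := extendWeight w) (φ := extendPot φ)
    (aux := extendWeight (nonnegPart w)) (d := d) hG t
  obtain ⟨j, hj⟩ := hinv.walk x ℓ hℓ
  rcases hj.exists_path hH with ⟨-, rfl⟩ | ⟨v, P, rfl, hP, rfl⟩
  · exact absurd hdℓ (not_lt.mpr hd)
  · refine ⟨v, P, _, hℓ, rfl, hP, rfl, ?_, rfl, hdℓ⟩
    -- the edge from the source to `v` is relaxed
    obtain ⟨ℓ₀, h1, h2⟩ := hinv.source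
    have h3 := hinv.dijkstra none ℓ₀ (some v) h1 (by simp [hQ])
      (mem_addSource_edges_none.mpr hP.mem_verts) (by
        simpa [reweight, extendWeight, extendPot] using hφ v hP.mem_verts)
    obtain ⟨ℓ₁, h4, h5⟩ := h3
    have h6 : pathLabel w (nonnegPart w) P = ℓ₁ := Option.some.inj (hℓ.symm.trans h4)
    have h7 : pathWeight w P = ℓ₁.dist := congrArg Label.dist h6
    rw [h7]
    simp only [extendWeight] at h5
    linarith

/-- The distances computed by a complete run are at most `0`, and make all edges nonnegative. -/
theorem runResult_spec (hH : EdgesInVerts H) {ψ : X → ℝ} (h : runResult H w φ d = some ψ) :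
    (∀ v ∈ H.verts, ψ v ≤ 0) ∧ ∀ e ∈ H.edges, 0 ≤ reweight w ψ e := by
  unfold runResult at h
  split_ifs at h with hfin
  have hG := wellFormed_addSource hH
  have hst := hfin.choose_spec
  generalize hfin.choose = t at h hst
  cases h
  have hrel := (bfdRun_halted hG t).2 hst
  have hinv := bfdInv_run (w := extendWeight w) (φ := extendPot φ)
    (aux := extendWeight (nonnegPart w)) (d := d) hG t
  have hlab : ∀ v ∈ H.verts, LabelLE ((run H w φ d t).label (some v)) 0 := by
    intro v hv
    obtain ⟨ℓ₀, h1, h2⟩ := hinv.source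
    have h3 := hrel none (some v) ℓ₀ h1 (mem_addSource_edges_none.mpr hv)
    exact h3.mono (by simpa [extendWeight] using h2)
  refine ⟨fun v hv => ?_, fun e he => ?_⟩
  · obtain ⟨ℓ, h1, h2⟩ := hlab v hv
    simpa only [BFDState.dist_eq h1] using h2
  · obtain ⟨ℓ, h1, -⟩ := hlab e.1 (hH e he).1
    obtain ⟨ℓ', h2', h3⟩ := hrel (some e.1) (some e.2) ℓ h1 (mem_addSource_edges_some.mpr he)
    have h2 : (run H w φ d t).label (some e.2) = some ℓ' := h2'
    simp only [reweight, BFDState.dist_eq h1, BFDState.dist_eq h2]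
    simp only [extendWeight] at h3
    linarith

end Paths

/-! ### The potential at a node of the decomposition tree -/

section Potential

variable {V : Type*}

theorem edgesInVerts_scc_deleteEdges (H : DGraph V) (S : Set (V × V))
    (v : V) : EdgesInVerts (scc (deleteEdges H S) v) := by
  intro e he
  have h1 := Finset.mem_filter.mp he
  exact ⟨Finset.mem_inter.mpr ⟨(Finset.mem_filter.mp h1.2.1).1, h1.2.1⟩,
    Finset.mem_inter.mpr ⟨(Finset.mem_filter.mp h1.2.2).1, h1.2.2⟩⟩

theorem scc_eq_of_reach {K : DGraph V} {a b : V} (hab : Reach K a b) (hba : Reach K b a) :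
    scc K a = scc K b := by
  unfold scc
  congr 1
  ext x
  simp only [Finset.mem_filter]
  exact and_congr_right fun _ => ⟨fun h => ⟨hba.trans h.1, h.2.trans hab⟩,
    fun h => ⟨hab.trans h.1, h.2.trans hba⟩⟩

variable [Fintype V]

theorem fixDAG_le (K : DGraph V) (w : V × V → ℝ) (φ : V → ℝ) (v : V) : fixDAG K w φ v ≤ φ v := by
  unfold fixDAG
  simp only
  have : ∀ j ∈ Finset.range ((exists_isTopological K).choose v + 1),
      (K.edges.filter (fun e => ¬ Reach K e.2 e.1 ∧ (exists_isTopological K).choose e.2 = j)).fold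
        min 0 (reweight w φ) ≤ 0 := fun j _ => Finset.fold_min_le (0 : ℝ) |>.mpr (Or.inl le_rfl)
  linarith [Finset.sum_nonpos this]

theorem reweight_fixDAG_nonneg {K : DGraph V} {w : V × V → ℝ} {φ : V → ℝ}
    (h : ∀ e ∈ K.edges, Reach K e.2 e.1 → 0 ≤ reweight w φ e) {e : V × V} (he : e ∈ K.edges) :
    0 ≤ reweight w (fixDAG K w φ) e := by
  have hτ := (exists_isTopological K).choose_spec e he
  unfold fixDAG
  generalize (exists_isTopological K).choose = τ at hτ ⊢
  simp only [reweight]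
  by_cases hr : Reach K e.2 e.1
  · rw [hτ.1 hr]
    have := h e he hr
    simp only [reweight] at this
    linarith
  · have hlt := hτ.2 hr
    set μ : ℕ → ℝ := fun j =>
      (K.edges.filter (fun e => ¬ Reach K e.2 e.1 ∧ τ e.2 = j)).fold min 0 (reweight w φ) with hμ
    have hμ0 : ∀ j, μ j ≤ 0 := fun j => Finset.fold_min_le (0 : ℝ) |>.mpr (Or.inl le_rfl)
    have hμe : μ (τ e.2) ≤ reweight w φ e :=
      Finset.fold_min_le _ |>.mpr (Or.inr ⟨e, by simp [he, hr], le_rfl⟩)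
    have h1 : ∑ j ∈ Finset.range (τ e.2 + 1), μ j ≤
        ∑ j ∈ Finset.range (τ e.1 + 1), μ j + μ (τ e.2) := by
      rw [Finset.sum_range_succ]
      have h2 := Finset.sum_range_add_sum_Ico μ (Nat.succ_le_of_lt hlt)
      have h3 : ∑ j ∈ Finset.Ico (τ e.1).succ (τ e.2), μ j ≤ 0 := Finset.sum_nonpos fun j _ => hμ0 j
      simp only [Nat.succ_eq_add_one] at h2 h3
      linarith
    simp only [reweight] at hμe
    linarith

/-- The potential with which `BellmanFordDijkstra(H, φ)` is run is at most `0`, and the only negative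
edges of `H_φ` are those cut by `Decompose`. -/
theorem potentialAt_spec {H : DGraph V} (hH : EdgesInVerts H) {w : V × V → ℝ} {W : ℕ}
    {ω : Table V} {k : ℕ} {φ : V → ℝ} (h : potentialAt w W ω H k = some φ) :
    (∀ v ∈ H.verts, φ v ≤ 0) ∧ ∀ e ∈ H.edges, e ∉ cutSet ω H k → 0 ≤ reweight w φ e := by
  rw [potentialAt] at h
  obtain ⟨child, hdef⟩ : ∃ child : H.verts → Option (V → ℝ), child = fun v : H.verts =>
      if _ : (W : ℝ) / 2 < diam (Fintype.card V) W (childIdx ω H k v) then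
        (potentialAt w W ω (childGraph ω H k v) (childIdx ω H k v)).bind fun φ =>
          runResult (childGraph ω H k v) w φ (diam (Fintype.card V) W (childIdx ω H k v))
      else if ∃ e ∈ (childGraph ω H k v).edges, w e < 0 then none
      else some (fun _ => 0) := ⟨_, rfl⟩
  replace h : (if ∀ v, (child v).isSome then
      some (fixDAG (deleteEdges H (cutSet ω H k)) w
        (fun v => if hv : v ∈ H.verts then (child ⟨v, hv⟩).getD 0 v else 0))
      else none) = some φ := by
    rw [hdef]
    exact h
  split_ifs at h with hsome
  cases h
  have hchild : ∀ v ψ, child v = some ψ → (∀ x ∈ (childGraph ω H k v).verts, ψ x ≤ 0) ∧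
      ∀ e ∈ (childGraph ω H k v).edges, 0 ≤ reweight w ψ e := by
    intro v ψ hv
    simp only [hdef] at hv
    split_ifs at hv with hleaf hneg
    · obtain ⟨φ', -, h2⟩ := Option.bind_eq_some_iff.mp hv
      exact runResult_spec (edgesInVerts_scc_deleteEdges _ _ _) h2
    · cases hv
      push Not at hneg
      exact ⟨fun _ _ => le_rfl, fun e he => by simpa [reweight] using hneg e he⟩
  have hcongr : ∀ v v' : H.verts, childGraph ω H k v = childGraph ω H k v' →
      child v = child v' := by
    intro v v' hvv
    have hi : childIdx ω H k v = childIdx ω H k v' := by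
      unfold childIdx
      rw [hvv]
    simp only [hdef, hvv, hi]
  have hself : ∀ v : H.verts, (v : V) ∈ (childGraph ω H k v).verts := fun v =>
    Finset.mem_inter.mpr ⟨v.2, Finset.mem_filter.mpr
      ⟨v.2, Relation.ReflTransGen.refl, Relation.ReflTransGen.refl⟩⟩
  refine ⟨fun v hv => (fixDAG_le _ _ _ _).trans ?_, fun e he hS => ?_⟩
  · obtain ⟨ψ, hψ⟩ := Option.isSome_iff_exists.mp (hsome ⟨v, hv⟩)
    simp only [hv, dif_pos, hψ, Option.getD_some]
    exact (hchild _ ψ hψ).1 v (hself ⟨v, hv⟩)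
  · refine reweight_fixDAG_nonneg (K := deleteEdges H (cutSet ω H k)) ?_
      (Finset.mem_filter.mpr ⟨he, hS⟩)
    intro f hf hr
    have hf' : Reach (deleteEdges H (cutSet ω H k)) f.1 f.2 := Relation.ReflTransGen.single hf
    have hfH : f ∈ H.edges := (Finset.mem_filter.mp hf).1
    obtain ⟨h1, h2⟩ := hH f hfH
    obtain ⟨ψ, hψ⟩ := Option.isSome_iff_exists.mp (hsome ⟨f.1, h1⟩)
    have hψ' : child ⟨f.2, h2⟩ = some ψ :=
      (hcongr ⟨f.2, h2⟩ ⟨f.1, h1⟩ (scc_eq_of_reach hr hf')).trans hψ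
    have h3 := (hchild _ ψ hψ).2 f (Finset.mem_filter.mpr ⟨hf, Finset.mem_filter.mpr
      ⟨h1, Relation.ReflTransGen.refl, Relation.ReflTransGen.refl⟩,
      Finset.mem_filter.mpr ⟨h2, hf', hr⟩⟩)
    simpa [reweight, h1, h2, hψ, hψ'] using h3

end Potential

/-! ### The probability that `Decompose` cuts an edge -/

section CutProbability

variable {V : Type*}

theorem geometric_apply {p : ℝ} (hp : 0 < p) (j : ℕ) :
    geometric p j = ENNReal.ofReal ((1 - min 1 p) ^ j * min 1 p) := by
  have hq : ((Set.projIcc (0 : ℝ) 1 zero_le_one p : unitInterval) : ℝ) = min 1 p := by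
    rw [Set.coe_projIcc]
    exact max_eq_right (le_min zero_le_one hp.le)
  have h0 : (Set.projIcc (0 : ℝ) 1 zero_le_one p : unitInterval) ≠ 0 := by
    intro h
    have := congrArg Subtype.val h
    rw [hq] at this
    exact (lt_min one_pos hp).ne' this
  unfold geometric
  rw [Measure.toPMF_apply, geometricMeasure_singleton h0, hq]

/-- The probability that a geometric random variable of parameter `p` is less than `m`. Since the
distribution is memoryless, it is also the probability that the variable is less than `D + m`,
conditioned on being at least `D`. -/
def geomCDF (p : ℝ) (m : ℕ) : ℝ := 1 - (1 - min 1 p) ^ m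

theorem geomCDF_le (p : ℝ) (m : ℕ) : geomCDF p m ≤ m * p := by
  have h1 : min 1 p ≤ 1 := min_le_left _ _
  have h2 : min 1 p ≤ p := min_le_right _ _
  have h := one_add_mul_le_pow (a := -min 1 p) (by linarith) m
  have h3 : (m : ℝ) * min 1 p ≤ m * p := mul_le_mul_of_nonneg_left h2 (Nat.cast_nonneg m)
  rw [← sub_eq_add_neg] at h
  unfold geomCDF
  linarith

theorem geomCDF_nonneg {p : ℝ} (hp : 0 < p) (m : ℕ) : 0 ≤ geomCDF p m := by
  have h1 : min 1 p ≤ 1 := min_le_left _ _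
  have h2 : 0 < min 1 p := lt_min one_pos hp
  exact sub_nonneg.mpr (pow_le_one₀ (by linarith) (by linarith))

/-- The use of memorylessness: if a cut happens with probability at most `geomCDF p m` when the
radius `j` is less than `D`, and never when it is at least `D + m`, then it happens with probability
at most `geomCDF p m`. -/
theorem tsum_geometric_mul_le {p : ℝ} (hp : 0 < p) (m D : ℕ) (F : ℕ → ℝ≥0∞)
    (h1 : ∀ j < D, F j ≤ ENNReal.ofReal (geomCDF p m)) (h2 : ∀ j, F j ≤ 1)
    (h3 : ∀ j, D + m ≤ j → F j = 0) :
    ∑' j, geometric p j * F j ≤ ENNReal.ofReal (geomCDF p m) := by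
  have hθ := geomCDF_nonneg hp m
  have hq1 : 0 ≤ 1 - min 1 p := sub_nonneg.mpr (min_le_left _ _)
  have hq0 : 0 ≤ min 1 p := (lt_min one_pos hp).le
  rw [tsum_eq_sum (s := Finset.range (D + m))
    (fun j hj => by rw [h3 j (by simpa using hj), mul_zero]), Finset.sum_range_add]
  have hsum : ∀ N : ℕ, ∑ j ∈ Finset.range N, (1 - min 1 p) ^ j * min 1 p =
      1 - (1 - min 1 p) ^ N := by
    intro N
    induction N with
    | zero => simp
    | succ N ih => rw [Finset.sum_range_succ, ih]; ring
  have e1 : ∑ j ∈ Finset.range D, geometric p j * F j ≤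
      ENNReal.ofReal ((1 - (1 - min 1 p) ^ D) * geomCDF p m) := by
    rw [← hsum, Finset.sum_mul, ENNReal.ofReal_sum_of_nonneg (fun j _ => by positivity)]
    refine Finset.sum_le_sum fun j hj => ?_
    rw [geometric_apply hp,
      ENNReal.ofReal_mul (p := (1 - min 1 p) ^ j * min 1 p) (by positivity)]
    exact mul_le_mul_right (h1 j (Finset.mem_range.mp hj)) _
  have e2 : ∑ i ∈ Finset.range m, geometric p (D + i) * F (D + i) ≤
      ENNReal.ofReal ((1 - min 1 p) ^ D * geomCDF p m) := by
    unfold geomCDF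
    rw [← hsum, Finset.mul_sum, ENNReal.ofReal_sum_of_nonneg (fun j _ => by positivity)]
    refine Finset.sum_le_sum fun i _ => ?_
    rw [geometric_apply hp]
    refine (mul_le_of_le_one_right' (h2 _)).trans (le_of_eq ?_)
    congr 1
    ring
  refine (add_le_add e1 e2).trans (le_of_eq ?_)
  have hpow : (1 - min 1 p) ^ D ≤ 1 := pow_le_one₀ hq1 (by linarith)
  rw [← ENNReal.ofReal_add (mul_nonneg (by linarith) hθ) (by positivity)]
  congr 1
  ring

theorem toOuterMeasure_le_one {α : Type*} (μ : PMF α) (s : Set α) : μ.toOuterMeasure s ≤ 1 := by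
  rw [PMF.toOuterMeasure_apply, ← μ.tsum_coe]
  exact ENNReal.tsum_le_tsum fun a => Set.indicator_le_self _ _ _

theorem toOuterMeasure_bind_le {α β : Type*} (μ : PMF α) (f : α → PMF β) (s : Set α) (t : Set β)
    {ε : ℝ≥0∞} (h : ∀ a ∉ s, (f a).toOuterMeasure t ≤ ε) :
    (μ.bind f).toOuterMeasure t ≤ μ.toOuterMeasure s + ε := by
  rw [PMF.toOuterMeasure_bind_apply, PMF.toOuterMeasure_apply]
  have hε : ε = ∑' a, μ a * ε := by rw [ENNReal.tsum_mul_right, PMF.tsum_coe, one_mul]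
  rw [hε, ← ENNReal.tsum_add]
  refine ENNReal.tsum_le_tsum fun a => ?_
  by_cases ha : a ∈ s
  · rw [Set.indicator_of_mem ha]
    exact (mul_le_of_le_one_right' (toOuterMeasure_le_one _ _)).trans le_self_add
  · exact (mul_le_mul_right (h a ha) _).trans le_add_self

section Carve

variable {H : DGraph V} {ball : DGraph V → V → ℝ → Finset V}
  {cut : Finset V → Finset V → Set (V × V)} {p : ℝ} {e : V × V} {x y : V}

/-- An edge with an endpoint that has been removed is not cut any more. -/
theorem carve_eq_zero (hball : ∀ K v r, ball K v r ⊆ K.verts)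
    (hcut : ∀ A B, e ∈ cut A B → x ∈ B ∧ y ∈ A \ B) (l : List V)
    (st : Finset V × Set (V × V)) (he : e ∉ st.2) (hxy : x ∈ st.1 → y ∉ st.1) :
    (carve H ball cut p l st).toOuterMeasure {s | e ∈ s.2} = 0 := by
  induction l generalizing st with
  | nil => simp [carve, he]
  | cons v l ih =>
    unfold carve
    split_ifs
    · rw [PMF.toOuterMeasure_bind_apply]
      refine ENNReal.tsum_eq_zero.mpr fun j => ?_
      rw [ih, mul_zero]
      · rintro (h | h)
        · exact he h
        · obtain ⟨h1, h2⟩ := hcut _ _ h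
          exact hxy (Finset.mem_inter.mp (hball _ _ _ h1)).2 (Finset.mem_sdiff.mp h2).1
      · intro h1 h2
        exact hxy (Finset.mem_sdiff.mp h1).1 (Finset.mem_sdiff.mp h2).1
    · exact ih st he hxy

/-- If balls whose radius is larger by `m / 2` contain `y` whenever they contain `x`, the carving cuts
the edge between `x` and `y` with probability at most `geomCDF p m`: at most one of the balls is the
first to contain `x`, and given that a ball contains `x`, it contains `y` unless its radius exceeds
the distance of `x` by less than `m / 2`. -/
theorem carve_le (hp : 0 < p) (m : ℕ) (hball : ∀ K v r, ball K v r ⊆ K.verts)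
    (hcut : ∀ A B, e ∈ cut A B → x ∈ B ∧ y ∈ A \ B)
    (hmono : ∀ A v (j j' : ℕ), x ∈ A → y ∈ A → x ∈ ball (induce H A) v ((j : ℝ) / 2) → j + m ≤ j' →
      y ∈ ball (induce H A) v ((j' : ℝ) / 2))
    (l : List V) (st : Finset V × Set (V × V)) (he : e ∉ st.2) :
    (carve H ball cut p l st).toOuterMeasure {s | e ∈ s.2} ≤ ENNReal.ofReal (geomCDF p m) := by
  induction l generalizing st with
  | nil => simp [carve, he]
  | cons v l ih =>
    by_cases hxy : x ∈ st.1 → y ∉ st.1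
    · rw [carve_eq_zero hball hcut _ st he hxy]
      exact zero_le
    push Not at hxy
    unfold carve
    split_ifs
    · rw [PMF.toOuterMeasure_bind_apply]
      have hout : ∀ j : ℕ, x ∉ ball (induce H st.1) v ((j : ℝ) / 2) →
          (carve H ball cut p l (st.1 \ ball (induce H st.1) v ((j : ℝ) / 2),
            st.2 ∪ cut st.1 (ball (induce H st.1) v ((j : ℝ) / 2)))).toOuterMeasure
              {s | e ∈ s.2} ≤ ENNReal.ofReal (geomCDF p m) := by
        refine fun j hj => ih _ ?_
        rintro (h | h)
        · exact he h
        · exact hj (hcut _ _ h).1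
      by_cases hex : ∃ j : ℕ, x ∈ ball (induce H st.1) v ((j : ℝ) / 2)
      · refine tsum_geometric_mul_le hp m (Nat.find hex) _
          (fun j hj => hout j (Nat.find_min hex hj)) (fun j => toOuterMeasure_le_one _ _) ?_
        intro j hj
        have hy := hmono st.1 v _ j hxy.1 hxy.2 (Nat.find_spec hex) hj
        refine carve_eq_zero hball hcut _ _ ?_ ?_
        · rintro (h | h)
          · exact he h
          · exact (Finset.mem_sdiff.mp (hcut _ _ h).2).2 hy
        · exact fun _ h => (Finset.mem_sdiff.mp h).2 hy
      · push Not at hex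
        refine (ENNReal.tsum_le_tsum fun j => mul_le_mul_right (hout j (hex j)) _).trans ?_
        rw [ENNReal.tsum_mul_right, PMF.tsum_coe, one_mul]
    · exact ih st he

end Carve

theorem outBall_extend {K : DGraph V} {w : V × V → ℝ} {a b v : V} {r r' : ℝ}
    (he : (a, b) ∈ K.edges) (hb : b ∈ K.verts) (ha : a ∈ outBall K w v r)
    (hr : r + w (a, b) ≤ r') : b ∈ outBall K w v r' := by
  obtain ⟨-, q, hq, hh, hw⟩ := Finset.mem_filter.mp ha
  refine Finset.mem_filter.mpr ⟨hb, q ++ [b], hq.snoc he hb, ?_, ?_⟩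
  · simp [List.head?_append, hh]
  · rw [pathWeight_snoc w hq.2]
    linarith

theorem inBall_extend {K : DGraph V} {w : V × V → ℝ} {a b v : V} {r r' : ℝ}
    (he : (a, b) ∈ K.edges) (ha : a ∈ K.verts) (hb : b ∈ inBall K w v r)
    (hr : r + w (a, b) ≤ r') : a ∈ inBall K w v r' := by
  obtain ⟨-, q, hq, hh, hw⟩ := Finset.mem_filter.mp hb
  obtain ⟨q, rfl⟩ := List.head?_eq_some_iff.mp hh
  refine Finset.mem_filter.mpr ⟨ha, a :: b :: q, ⟨⟨by simp, ?_, ?_⟩, ?_⟩, rfl, ?_⟩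
  · intro x hx
    rcases List.mem_cons.mp hx with rfl | hx
    · exact ha
    · exact hq.1.2.1 x hx
  · exact List.isChain_cons_cons.mpr ⟨he, hq.1.2.2⟩
  · rw [← hq.2, List.getLast?_cons_cons]
  · simp only [pathWeight, walkEdges_cons_cons, List.map_cons, List.sum_cons] at hw ⊢
    linarith

/-- An edge of `H_{≥ 0}` of weight `m / 2` is cut by `Decompose(H, d)` with probability at most
`2 m` times the parameter `c log n / d` of the geometric distribution. -/
theorem decompose_le {c d : ℝ} (hc : 0 < c) (hd : 0 < d) (n : ℕ) {w : V × V → ℝ} {H : DGraph V}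
    (hH : EdgesInVerts H) {e : V × V} (he : e ∈ H.edges) (m : ℕ)
    (hm : nonnegPart w e = (m : ℝ) / 2) :
    (decompose c n w H d).toOuterMeasure {S | e ∈ S} ≤
      ENNReal.ofReal (2 * m * (c * lg n / d)) := by
  have hp : 0 < c * lg n / d := by
    have : 0 < lg n := lt_of_lt_of_le one_pos (le_max_left _ _)
    positivity
  have hne : H.verts.Nonempty := ⟨_, (hH e he).1⟩
  have hθ := geomCDF_nonneg hp m
  have hind : ∀ A, e.1 ∈ A → e.2 ∈ A → (e.1, e.2) ∈ (induce H A).edges ∧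
      e.1 ∈ (induce H A).verts ∧ e.2 ∈ (induce H A).verts := fun A h1 h2 =>
    ⟨Finset.mem_filter.mpr ⟨he, h1, h2⟩, Finset.mem_inter.mpr ⟨(hH e he).1, h1⟩,
      Finset.mem_inter.mpr ⟨(hH e he).2, h2⟩⟩
  have hrad : ∀ j j' : ℕ, j + m ≤ j' → (j : ℝ) / 2 + nonnegPart w (e.1, e.2) ≤ (j' : ℝ) / 2 := by
    intro j j' h
    have h' : (j : ℝ) + m ≤ j' := by exact_mod_cast h
    change (j : ℝ) / 2 + nonnegPart w e ≤ _
    rw [hm]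
    linarith
  have hfinal : ENNReal.ofReal (geomCDF (c * lg n / d) m) + ENNReal.ofReal (geomCDF (c * lg n / d) m)
      ≤ ENNReal.ofReal (2 * m * (c * lg n / d)) := by
    rw [← ENNReal.ofReal_add hθ hθ]
    refine ENNReal.ofReal_le_ofReal ?_
    linarith [geomCDF_le (c * lg n / d) m]
  unfold decompose
  rw [dif_pos hne]
  simp only
  refine (toOuterMeasure_bind_le _ _ ∅ _ (ε := ENNReal.ofReal (2 * m * (c * lg n / d)))
    fun x _ => ?_).trans (by rw [measure_empty, zero_add])
  refine (toOuterMeasure_bind_le _ _ {st | e ∈ st.2} _ fun st hst => ?_).trans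
    ((add_le_add_left ?_ _).trans hfinal)
  · rw [PMF.toOuterMeasure_map_apply]
    refine carve_le (x := e.2) (y := e.1) hp m (fun K v r => Finset.filter_subset _ _)
      (fun A B h => ⟨h.2.2, h.2.1⟩) ?_ _ _ hst
    intro A v j j' h2 h1 h hjj
    obtain ⟨h3, h4, h5⟩ := hind A h1 h2
    exact inBall_extend h3 h4 h (hrad j j' hjj)
  · refine carve_le (x := e.1) (y := e.2) hp m (fun K v r => Finset.filter_subset _ _)
      (fun A B h => ⟨h.2.1, h.2.2⟩) ?_ _ _ (Set.notMem_empty e)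
    intro A v j j' h1 h2 h hjj
    obtain ⟨h3, h4, h5⟩ := hind A h1 h2
    exact outBall_extend h3 h5 h (hrad j j' hjj)

end CutProbability

theorem one_le_lg (n : ℕ) : 1 ≤ lg n := le_max_left _ _

theorem diam_pos {n W : ℕ} (hn : 0 < n) (hW : 0 < W) (k : ℕ) : 0 < diam n W k := by
  unfold diam
  positivity

/-! ### Independence of the node and the cut set drawn there -/

section Independence

variable {V : Type*} [Fintype V] {E : Finset (V × V)} {W : ℕ} {ω ω' : Table V} {H : DGraph V}
  {k : ℕ}

/-- The entry of the table that is used at the node `(H, d₀ / 2 ^ k)`. -/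
abbrev tableKey (H : DGraph V) (k : ℕ) :
    Finset V × Finset (V × V) × Fin (Fintype.card V + 1) :=
  (H.verts, H.edges, Fin.ofNat (Fintype.card V + 1) k)

theorem IsNode.edgesInVerts (h : IsNode E W ω H k) : EdgesInVerts H := by
  cases h with
  | root => exact fun e _ => ⟨Finset.mem_univ _, Finset.mem_univ _⟩
  | child => exact edgesInVerts_scc_deleteEdges _ _ _

theorem IsNode.verts_nonempty [Nonempty V] (h : IsNode E W ω H k) : H.verts.Nonempty := by
  cases h with
  | root => exact Finset.univ_nonempty
  | child H k v _ hv =>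
    exact ⟨v, Finset.mem_inter.mpr ⟨hv, Finset.mem_filter.mpr
      ⟨hv, Relation.ReflTransGen.refl, Relation.ReflTransGen.refl⟩⟩⟩

theorem IsNode.le_card (h : IsNode E W ω H k) : k ≤ Fintype.card V := by
  induction h with
  | root => exact Nat.zero_le _
  | child H k v _ hv hd ih =>
    unfold childIdx at hd ⊢
    split_ifs at hd ⊢ with hc
    · exact ih
    · by_contra hk
      have h3 : (Fintype.card V : ℝ) ≤ 2 ^ (k + 1) := by
        exact_mod_cast (not_le.mp hk).le.trans Nat.lt_two_pow_self.le
      refine absurd hd (not_lt.mpr ?_)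
      unfold diam
      rw [div_le_iff₀ (by positivity)]
      have : (0 : ℝ) ≤ W := Nat.cast_nonneg W
      nlinarith

/-- Whether `(H, d)` is a node does not depend on the table entry used at `(H, d)`, since all strict
ancestors of `(H, d)` use other entries. -/
theorem IsNode.congr (hk : k ≤ Fintype.card V) (hω : ∀ key ≠ tableKey H k, ω key = ω' key)
    {H' : DGraph V} {k' : ℕ} (h : IsNode E W ω H' k')
    (hle : H.verts.card + (Fintype.card V - k) ≤ H'.verts.card + (Fintype.card V - k')) :
    IsNode E W ω' H' k' := by
  induction h with
  | root => exact IsNode.root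
  | child H₁ k₁ v h₁ hv hd ih =>
    have hlt := hle.trans_lt (child_decreases W ω H₁ k₁ v hv hd)
    have hcut : cutSet ω H₁ k₁ = cutSet ω' H₁ k₁ := by
      refine hω _ fun heq => ?_
      simp only [tableKey, Prod.mk.injEq] at heq
      have hkk : k₁ = k := by
        have := congrArg Fin.val heq.2.2
        simp only [Fin.ofNat] at this
        rwa [Nat.mod_eq_of_lt (Nat.lt_succ_of_le h₁.le_card),
          Nat.mod_eq_of_lt (Nat.lt_succ_of_le hk)] at this
      rw [heq.1, hkk] at hlt
      exact lt_irrefl _ hlt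
    have hchild : childGraph ω H₁ k₁ v = childGraph ω' H₁ k₁ v := by
      unfold childGraph
      rw [hcut]
    have hidx : childIdx ω H₁ k₁ v = childIdx ω' H₁ k₁ v := by
      unfold childIdx
      rw [hchild]
    rw [hchild, hidx]
    exact IsNode.child H₁ k₁ v (ih hlt.le) hv (hidx ▸ hd)

/-- In a product of probability measures on discrete spaces, an event that does not depend on the
coordinate `i₀` is independent of every event that depends on the coordinate `i₀` only. -/
theorem pi_inter_eval_preimage {ι : Type*} [Fintype ι] {α : ι → Type*} [∀ i, MeasurableSpace (α i)]
    [∀ i, Countable (α i)] [∀ i, MeasurableSingletonClass (α i)]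
    (μ : ∀ i, Measure (α i)) [∀ i, IsProbabilityMeasure (μ i)] (i₀ : ι) (N : Set (∀ i, α i))
    (hN : ∀ x y : ∀ i, α i, (∀ i ≠ i₀, x i = y i) → x ∈ N → y ∈ N)
    [Finite (∀ i, α i)] (B : Set (α i₀)) :
    Measure.pi μ (N ∩ (fun x => x i₀) ⁻¹' B) = Measure.pi μ N * μ i₀ B := by
  have hind : iIndepFun (fun i (x : ∀ i, α i) => x i) (Measure.pi μ) :=
    iIndepFun_pi (X := fun i (x : α i) => x) fun i => aemeasurable_id
  have h2 := hind.indepFun_finset (Finset.univ.erase i₀) {i₀} (by simp)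
    (fun i => measurable_pi_apply i)
  let f : (∀ i, α i) → ∀ i : (Finset.univ.erase i₀ : Finset ι), α i := fun x i => x i
  let g : (∀ i, α i) → ∀ i : ({i₀} : Finset ι), α i := fun x i => x i
  have hNf : N = f ⁻¹' (f '' N) := by
    refine Set.Subset.antisymm (Set.subset_preimage_image f N) ?_
    rintro y ⟨x, hx, hxy⟩
    exact hN x y (fun i hi => congrFun hxy ⟨i, by simp [hi]⟩) hx
  have hBg : (fun x : ∀ i, α i => x i₀) ⁻¹' B =
      g ⁻¹' {z | z ⟨i₀, Finset.mem_singleton_self i₀⟩ ∈ B} := rfl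
  have h3 := h2.measure_inter_preimage_eq_mul (f '' N)
    {z | z ⟨i₀, Finset.mem_singleton_self i₀⟩ ∈ B} (Set.to_countable _).measurableSet
    (measurable_pi_apply _ (Set.to_countable B).measurableSet)
  change Measure.pi μ (f ⁻¹' (f '' N) ∩ g ⁻¹' _) = Measure.pi μ (f ⁻¹' (f '' N)) *
    Measure.pi μ (g ⁻¹' _) at h3
  rw [← hNf, ← hBg] at h3
  rw [h3]
  congr 1
  exact (measurePreserving_eval μ i₀).measure_preimage (Set.to_countable B).measurableSet.nullMeasurableSet

variable {c : ℝ} {wG : V × V → ℤ}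

instance isProbabilityMeasure_tableLaw : IsProbabilityMeasure (tableLaw c wG W) := by
  unfold tableLaw
  infer_instance

/-- Conditioning on `(H, d)` being a node, and on a further event of conditional probability at least
`1 / 2`, at most doubles the probability that `Decompose(H, d)` cuts an edge. -/
theorem cond_cutSet_le {A : Set (Table V)} (h0 : 0 < tableLaw c wG W {ω | IsNode E W ω H k})
    (hA : tableLaw c wG W {ω | IsNode E W ω H k} ≤
      2 * tableLaw c wG W ({ω | IsNode E W ω H k} ∩ A)) (e : V × V) :
    ProbabilityTheory.cond (tableLaw c wG W) ({ω | IsNode E W ω H k} ∩ A)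
        {ω | e ∈ cutSet ω H k} ≤
      2 * (decompose c (Fintype.card V) (scaledWeight wG W) H
        (diam (Fintype.card V) W k)).toOuterMeasure {S | e ∈ S} := by
  obtain ⟨ω₀, hω₀⟩ : {ω | IsNode E W ω H k}.Nonempty := nonempty_of_measure_ne_zero h0.ne'
  have hk : k ≤ Fintype.card V := IsNode.le_card hω₀
  have hind : tableLaw c wG W ({ω | IsNode E W ω H k} ∩ {ω | e ∈ cutSet ω H k}) =
      tableLaw c wG W {ω | IsNode E W ω H k} *
        (decompose c (Fintype.card V) (scaledWeight wG W) H
          (diam (Fintype.card V) W k)).toMeasure {S | e ∈ S} := by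
    have := pi_inter_eval_preimage (fun key : Finset V × Finset (V × V) × Fin (Fintype.card V + 1) =>
      (decompose c (Fintype.card V) (scaledWeight wG W) ⟨key.1, key.2.1⟩
        (diam (Fintype.card V) W key.2.2)).toMeasure) (tableKey H k)
      {ω : Table V | IsNode E W ω H k} (fun x y hxy hx => IsNode.congr hk hxy hx le_rfl)
      {S | e ∈ S}
    have hval : ((tableKey H k).2.2 : ℕ) = k := by
      simp only [Fin.ofNat]
      exact Nat.mod_eq_of_lt (Nat.lt_succ_of_le hk)
    rw [hval] at this
    exact this
  rw [(PMF.toMeasure_apply_eq_toOuterMeasure_apply _ (Set.to_countable _).measurableSet)] at hind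
  have hpos : tableLaw c wG W ({ω | IsNode E W ω H k} ∩ A) ≠ 0 := by
    intro h
    rw [h, mul_zero] at hA
    exact absurd hA (not_le.mpr h0)
  rw [cond_apply (Set.to_countable _).measurableSet]
  refine (ENNReal.inv_mul_le_iff hpos (measure_ne_top _ _)).mpr ?_
  refine (measure_mono (Set.inter_subset_inter_left _ Set.inter_subset_left)).trans ?_
  rw [hind, mul_left_comm, ← mul_assoc]
  exact mul_le_mul_left hA _

/-- The expected number of edges of a path that are cut by `Decompose(H, d)` is `O(log n)` if the
path has weight at most `d` in `H_{≥ 0}`. -/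
theorem lintegral_count_cut_le [Nonempty V] (hc : 0 < c) (hW : 0 < W) {A : Set (Table V)}
    (h0 : 0 < tableLaw c wG W {ω | IsNode E W ω H k})
    (hA : tableLaw c wG W {ω | IsNode E W ω H k} ≤
      2 * tableLaw c wG W ({ω | IsNode E W ω H k} ∩ A)) {l : List (V × V)}
    (hl : ∀ e ∈ l, e ∈ H.edges)
    (hd : (l.map (nonnegPart (scaledWeight wG W))).sum ≤ diam (Fintype.card V) W k) :
    ∫⁻ ω, (l.countP (fun e => decide (e ∈ cutSet ω H k)) : ℕ)
        ∂(ProbabilityTheory.cond (tableLaw c wG W) ({ω | IsNode E W ω H k} ∩ A)) ≤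
      ENNReal.ofReal (8 * c * lg (Fintype.card V)) := by
  obtain ⟨ω₀, hω₀⟩ : {ω | IsNode E W ω H k}.Nonempty := nonempty_of_measure_ne_zero h0.ne'
  have hH : EdgesInVerts H := IsNode.edgesInVerts hω₀
  set P := ProbabilityTheory.cond (tableLaw c wG W) ({ω | IsNode E W ω H k} ∩ A)
  set d := diam (Fintype.card V) W k
  set n := Fintype.card V
  have hdpos : 0 < d := diam_pos Fintype.card_pos hW k
  have hlg : 0 < lg n := one_pos.trans_le (one_le_lg n)
  have hP : ∀ e ∈ H.edges, P {ω | e ∈ cutSet ω H k} ≤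
      ENNReal.ofReal (8 * (c * lg n / d) * nonnegPart (scaledWeight wG W) e) := by
    intro e he
    -- in the scaled graph, all weights are half-integral
    have hm : nonnegPart (scaledWeight wG W) e = ((2 * wG e + W).toNat : ℝ) / 2 := by
      have h1 : (((2 * wG e + W).toNat : ℤ) : ℝ) = max 0 (2 * (wG e : ℝ) + W) := by
        rw [Int.toNat_eq_max, max_comm]
        push_cast
        rfl
      have h2 : ((2 * wG e + W).toNat : ℝ) = max 0 (2 * (wG e : ℝ) + W) := by
        rw [← h1]
        norm_cast
      rw [h2]
      simp only [nonnegPart, scaledWeight]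
      rcases le_total 0 ((wG e : ℝ) + W / 2) with h | h
      · rw [max_eq_right h, max_eq_right (by linarith)]
        ring
      · rw [max_eq_left h, max_eq_left (by linarith)]
        ring
    refine (cond_cutSet_le h0 hA e).trans ?_
    refine (mul_le_mul_right (decompose_le hc hdpos n hH he _ hm) 2).trans (le_of_eq ?_)
    rw [hm, ← ENNReal.ofReal_ofNat 2, ← ENNReal.ofReal_mul (by norm_num)]
    congr 1
    ring
  have hsum : ∀ l : List (V × V), (∀ e ∈ l, e ∈ H.edges) →
      ∫⁻ ω, (l.countP (fun e => decide (e ∈ cutSet ω H k)) : ℕ) ∂P ≤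
        ENNReal.ofReal (8 * (c * lg n / d) *
          (l.map (nonnegPart (scaledWeight wG W))).sum) := by
    intro l hl
    induction l with
    | nil => simp
    | cons e l ih =>
      have hw0 : 0 ≤ (l.map (nonnegPart (scaledWeight wG W))).sum :=
        List.sum_nonneg (by simp only [List.mem_map]; rintro _ ⟨f, -, rfl⟩; exact le_max_left _ _)
      have hw1 : 0 ≤ nonnegPart (scaledWeight wG W) e := le_max_left _ _
      rw [List.map_cons, List.sum_cons, mul_add, ENNReal.ofReal_add (by positivity) (by positivity)]
      have he : ∀ ω : Table V,
          (((e :: l).countP (fun e => decide (e ∈ cutSet ω H k)) : ℕ) : ℝ≥0∞) =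
          {ω | e ∈ cutSet ω H k}.indicator 1 ω +
            (l.countP (fun e => decide (e ∈ cutSet ω H k)) : ℕ) := by
        intro ω
        by_cases h : e ∈ cutSet ω H k
        · simp [h, Set.indicator, add_comm]
        · simp [h, Set.indicator]
      simp only [he]
      rw [lintegral_add_left (Measurable.of_discrete),
        lintegral_indicator_one (Set.to_countable _).measurableSet]
      exact add_le_add (hP e (hl e List.mem_cons_self))
        (ih fun f hf => hl f (List.mem_cons_of_mem _ hf))
  refine (hsum l hl).trans (ENNReal.ofReal_le_ofReal ?_)
  calc 8 * (c * lg n / d) * (l.map (nonnegPart (scaledWeight wG W))).sum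
      ≤ 8 * (c * lg n / d) * d := mul_le_mul_of_nonneg_left hd (by positivity)
    _ = 8 * c * lg n := by field_simp

end Independence

/-! ### Expected running time -/

section Expectation

theorem bfdStepTime_nonneg {X : Type*} (G : DGraph X) (s : X) (φ : X → ℝ) (st : BFDState X) :
    0 ≤ bfdStepTime G s φ st := by
  cases h : st.status with
  | running => exact zero_le_one.trans (one_le_bfdStepTime h)
  | finished => simp [bfdStepTime, h]
  | aborted => simp [bfdStepTime, h]

theorem runTime_le {X : Type*} {H : DGraph X} (hH : EdgesInVerts H) {w : X × X → ℝ} {φ : X → ℝ}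
    {d : ℝ} {B : Option X → ℕ}
    (hB : ∀ t, ∀ x ∈ (run H w φ d t).marked, (run H w φ d t).iter ≤ B x) :
    runTime H w φ d ≤ ((addSource H).verts.card + (addSource H).edges.card : ℕ) +
      ∑ x ∈ (addSource H).verts, (B x : ℝ≥0∞) * ENNReal.ofReal (extractCost (addSource H) x) := by
  unfold runTime
  gcongr
  refine ENNReal.tsum_le_of_sum_range_le fun T => ?_
  rw [← ENNReal.ofReal_sum_of_nonneg fun t _ => bfdStepTime_nonneg _ _ _ _]
  refine (ENNReal.ofReal_le_ofReal (sum_bfdStepTime_le (wellFormed_addSource hH) hB T)).trans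
    (le_of_eq ?_)
  rw [ENNReal.ofReal_sum_of_nonneg
    fun x _ => mul_nonneg (Nat.cast_nonneg _) (extractCost_nonneg _ _)]
  refine Finset.sum_congr rfl fun x _ => ?_
  rw [ENNReal.ofReal_mul (Nat.cast_nonneg _), ENNReal.ofReal_natCast]

theorem one_le_lglg (n : ℕ) : 1 ≤ lglg n := le_max_left _ _

theorem lglg_succ_le {n : ℕ} (hn : 1 ≤ n) : lglg (n + 1) ≤ 2 * lglg n := by
  have h1 := one_le_lglg n
  refine max_le (by linarith) ?_
  rcases hn.eq_or_lt with rfl | hn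
  · -- here `log log 2 ≤ 0`
    have h2 : Real.log (Real.log 2) ≤ 0 :=
      Real.log_nonpos (Real.log_nonneg (by norm_num)) (by linarith [Real.log_two_lt_d9])
    norm_num at *
    linarith
  · have hn' : (2 : ℝ) ≤ n := by exact_mod_cast hn
    have hl : 0 < Real.log n := Real.log_pos (by linarith)
    -- `n + 1 ≤ n ^ 2`
    have h2 : Real.log ((n + 1 : ℕ) : ℝ) ≤ 2 * Real.log n := by
      have : Real.log ((n : ℝ) ^ 2) = 2 * Real.log n := by
        rw [Real.log_pow]
        norm_num
      rw [← this]
      refine Real.log_le_log (by positivity) ?_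
      push_cast
      nlinarith
    have h3 : 0 < Real.log ((n + 1 : ℕ) : ℝ) := Real.log_pos (by push_cast; linarith)
    have h4 : Real.log (Real.log ((n + 1 : ℕ) : ℝ)) ≤ Real.log 2 + Real.log (Real.log n) := by
      rw [← Real.log_mul (by norm_num) hl.ne']
      exact Real.log_le_log h3 h2
    have h5 : Real.log (Real.log n) ≤ lglg n := le_max_right _ _
    linarith [Real.log_two_lt_d9]

theorem sum_outdeg {X : Type*} {G : DGraph X} {s : X} (hG : WellFormed G s) :
    ∑ x ∈ G.verts, (outdeg G x : ℝ) = G.edges.card := by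
  rw [Finset.card_eq_sum_card_fiberwise (f := Prod.fst) (t := G.verts) fun e he => hG.fst_mem he]
  push_cast
  rfl

theorem card_addSource_verts {X : Type*} (H : DGraph X) :
    (addSource H).verts.card = H.verts.card + 1 := by
  simp only [addSource]
  rw [Finset.card_insert_of_notMem (by simp), Finset.card_image_of_injective _ (Option.some_injective X)]

theorem card_addSource_edges_le {X : Type*} (H : DGraph X) :
    (addSource H).edges.card ≤ H.edges.card + H.verts.card :=
  (Finset.card_union_le _ _).trans (add_le_add Finset.card_image_le Finset.card_image_le)

theorem sum_extractCost_le {X : Type*} {H : DGraph X} (hH : EdgesInVerts H)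
    (hne : H.verts.Nonempty) : ∑ x ∈ (addSource H).verts, extractCost (addSource H) x ≤
      12 * (H.edges.card + H.verts.card * lglg H.verts.card) := by
  have hn : 1 ≤ H.verts.card := hne.card_pos
  have hn' : (1 : ℝ) ≤ H.verts.card := by exact_mod_cast hn
  have hm : ((addSource H).edges.card : ℝ) ≤ H.edges.card + H.verts.card := by
    exact_mod_cast card_addSource_edges_le H
  have hm0 : (0 : ℝ) ≤ H.edges.card := Nat.cast_nonneg _
  unfold extractCost
  rw [Finset.sum_add_distrib, ← Finset.mul_sum, sum_outdeg (wellFormed_addSource hH),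
    Finset.sum_const, card_addSource_verts, nsmul_eq_mul]
  push_cast
  have h1 := lglg_succ_le hn
  have h2 := one_le_lglg H.verts.card
  have h0 := one_le_lglg (H.verts.card + 1)
  generalize lglg (H.verts.card + 1) = L' at h0 h1 ⊢
  generalize lglg H.verts.card = L at h1 h2 ⊢
  have h3 : ((H.verts.card : ℝ) + 1) * (L' + 3) ≤ (2 * H.verts.card) * (5 * L) :=
    mul_le_mul (by linarith) (by linarith) (by linarith) (by positivity)
  have h4 : (H.verts.card : ℝ) * 1 ≤ H.verts.card * L := by gcongr
  linarith

variable {V : Type*} [Fintype V] {E : Finset (V × V)} {wG : V × V → ℤ} {W : ℕ}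
  {H : DGraph V} {k : ℕ} {c : ℝ} {A : Set (Table V)}

/-- The number of edges in the list `l` that are cut by `Decompose(H, d)`. -/
abbrev cutCount (H : DGraph V) (k : ℕ) (l : List (V × V)) (ω : Table V) : ℕ :=
  l.countP (fun e => decide (e ∈ cutSet ω H k))

theorem negCount_le_cutCount {w : V × V → ℝ} {ω : Table V} {φ : V → ℝ} (hH : EdgesInVerts H)
    (hφ : potentialAt w W ω H k = some φ) {p : List V} {v : V} (hp : IsPathTo H p v) :
    negCount (reweight w φ) p ≤ cutCount H k (walkEdges p) ω := by
  refine List.countP_mono_left fun e he hneg => ?_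
  by_contra hcut
  exact absurd ((potentialAt_spec hH hφ).2 e (hp.mem_edges e he) (by simpa using hcut))
    (not_le.mpr (by simpa using hneg))

/-- The expected running time, if each vertex `x` takes part in at most `2` iterations more than
there are cut edges in a list `L x` of edges of total weight at most `d` in `H_{≥ 0}`. -/
theorem lintegral_timeAt_le [Nonempty V] (hc : 0 < c) (hW : 0 < W)
    (h0 : 0 < tableLaw c wG W {ω | IsNode E W ω H k})
    (hA : tableLaw c wG W {ω | IsNode E W ω H k} ≤
      2 * tableLaw c wG W ({ω | IsNode E W ω H k} ∩ A))
    (hH : EdgesInVerts H) (hne : H.verts.Nonempty) (L : Option V → List (V × V))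
    (hL : ∀ x, ∀ e ∈ L x, e ∈ H.edges)
    (hd : ∀ x, ((L x).map (nonnegPart (scaledWeight wG W))).sum ≤ diam (Fintype.card V) W k)
    (hiter : ∀ ω φ, potentialAt (scaledWeight wG W) W ω H k = some φ →
      ∀ t, ∀ x ∈ (run H (scaledWeight wG W) φ (diam (Fintype.card V) W k) t).marked,
        (run H (scaledWeight wG W) φ (diam (Fintype.card V) W k) t).iter ≤
          cutCount H k (L x) ω + 2) :
    ∫⁻ ω, timeAt (scaledWeight wG W) W H k ω
        ∂(ProbabilityTheory.cond (tableLaw c wG W) ({ω | IsNode E W ω H k} ∩ A)) ≤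
      ENNReal.ofReal ((12 * (8 * c + 2) + 3) *
        ((H.edges.card + H.verts.card * lglg H.verts.card) * lg (Fintype.card V))) := by
  set P := ProbabilityTheory.cond (tableLaw c wG W) ({ω | IsNode E W ω H k} ∩ A)
  set n := Fintype.card V
  have hP1 : P Set.univ ≤ 1 := prob_le_one
  have hlg := one_le_lg n
  set prep : ℕ := (addSource H).verts.card + (addSource H).edges.card with hprep
  have hpt : ∀ ω, timeAt (scaledWeight wG W) W H k ω ≤ prep +
      ∑ x ∈ (addSource H).verts, ((cutCount H k (L x) ω : ℝ≥0∞) + 2) *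
        ENNReal.ofReal (extractCost (addSource H) x) := by
    intro ω
    unfold timeAt
    split
    · exact zero_le
    · rename_i φ hφ
      refine (runTime_le hH (hiter ω φ hφ)).trans (le_of_eq ?_)
      simp only [hprep, Nat.cast_add, Nat.cast_ofNat]
  have hcount : ∀ x, ∫⁻ ω, ((cutCount H k (L x) ω : ℝ≥0∞) + 2) ∂P ≤
      ENNReal.ofReal (8 * c * lg n + 2) := by
    intro x
    rw [lintegral_add_left Measurable.of_discrete, lintegral_const,
      ENNReal.ofReal_add (by positivity) zero_le_two, ENNReal.ofReal_ofNat]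
    exact add_le_add (lintegral_count_cut_le hc hW h0 hA (hL x) (hd x)) (mul_le_of_le_one_right' hP1)
  calc ∫⁻ ω, timeAt (scaledWeight wG W) W H k ω ∂P
      ≤ ∫⁻ ω, (prep + ∑ x ∈ (addSource H).verts, ((cutCount H k (L x) ω : ℝ≥0∞) + 2) *
          ENNReal.ofReal (extractCost (addSource H) x)) ∂P := lintegral_mono hpt
    _ = prep * P Set.univ + ∑ x ∈ (addSource H).verts,
          (∫⁻ ω, ((cutCount H k (L x) ω : ℝ≥0∞) + 2) ∂P) *
            ENNReal.ofReal (extractCost (addSource H) x) := by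
        rw [lintegral_add_left Measurable.of_discrete, lintegral_const,
          lintegral_finsetSum _ fun x _ => Measurable.of_discrete]
        congr 1
        exact Finset.sum_congr rfl fun x _ => lintegral_mul_const _ Measurable.of_discrete
    _ ≤ prep + ∑ x ∈ (addSource H).verts, ENNReal.ofReal (8 * c * lg n + 2) *
            ENNReal.ofReal (extractCost (addSource H) x) := by
        refine add_le_add (mul_le_of_le_one_right' hP1) (Finset.sum_le_sum fun x _ => ?_)
        exact mul_le_mul_left (hcount x) _
    _ = ENNReal.ofReal (prep + (8 * c * lg n + 2) *
          ∑ x ∈ (addSource H).verts, extractCost (addSource H) x) := by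
        have h1 : 0 ≤ ∑ x ∈ (addSource H).verts, extractCost (addSource H) x :=
          Finset.sum_nonneg fun x _ => extractCost_nonneg _ x
        rw [ENNReal.ofReal_add (p := (prep : ℝ)) (by positivity) (by positivity), ENNReal.ofReal_natCast,
          ENNReal.ofReal_mul (by positivity),
          ENNReal.ofReal_sum_of_nonneg fun x _ => extractCost_nonneg _ x, Finset.mul_sum]
    _ ≤ _ := by
        refine ENNReal.ofReal_le_ofReal ?_
        have h1 := sum_extractCost_le hH hne
        have h2 : (prep : ℝ) ≤ 3 * (H.edges.card + H.verts.card * lglg H.verts.card) := by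
          have hm : ((addSource H).edges.card : ℝ) ≤ H.edges.card + H.verts.card := by
            exact_mod_cast card_addSource_edges_le H
          have hn' : (1 : ℝ) ≤ H.verts.card := by exact_mod_cast hne.card_pos
          have h4 : (H.verts.card : ℝ) * 1 ≤ H.verts.card * lglg H.verts.card := by
            gcongr
            exact one_le_lglg _
          have hm0 : (0 : ℝ) ≤ H.edges.card := Nat.cast_nonneg _
          rw [hprep, card_addSource_verts]
          push_cast
          linarith
        have hM0 : 0 ≤ (H.edges.card : ℝ) + H.verts.card * lglg H.verts.card := by
          have := lglg_nonneg H.verts.card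
          positivity
        generalize (H.edges.card : ℝ) + H.verts.card * lglg H.verts.card = M at h1 h2 hM0 ⊢
        have h5 : 3 * M * 1 ≤ 3 * M * lg n := by gcongr
        have h6 : (8 * c * lg n + 2) * ∑ x ∈ (addSource H).verts, extractCost (addSource H) x ≤
            ((8 * c + 2) * lg n) * (12 * M) :=
          mul_le_mul (by linarith) h1 (Finset.sum_nonneg fun x _ => extractCost_nonneg _ x)
            (by positivity)
        linarith

end Expectation

end NegSSSP

end

theorem mainTheorem4 (c : ℝ) (hc : 0 < c) :
    ∃ C : ℝ, 0 < C ∧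
      ∀ (V : Type) [Fintype V] [Nonempty V]
        (E : Finset (V × V)) (wG : V × V → ℤ) (W : ℕ), 0 < W →
        (∀ e ∈ E, -(W : ℤ) ≤ wG e) →
      ∀ (H : DGraph V) (k : ℕ),
        NoNegCycle H (scaledWeight wG W) →
      ∀ A : Set (Table V),
        0 < tableLaw c wG W {ω | IsNode E W ω H k} →
        tableLaw c wG W {ω | IsNode E W ω H k} ≤
          2 * tableLaw c wG W ({ω | IsNode E W ω H k} ∩ A) →
        -- `n`, the weights of `H`, its parameter `d`, and the conditional law given the node
        let n := Fintype.card V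
        let w := scaledWeight wG W
        let d := diam n W k
        let P := ProbabilityTheory.cond (tableLaw c wG W) ({ω | IsNode E W ω H k} ∩ A)
        -- the expected running time
        (∫⁻ ω, timeAt w W H k ω ∂P ≤
          ENNReal.ofReal (C * ((H.edges.card + H.verts.card * lglg H.verts.card) * lg n))) ∧
        -- shortest paths have weight at most `d` in `H_{≥ 0}` and expected `O(log n)` negative edges
        (((∀ v ∈ H.verts, ∃ p, IsShortestPathTo H w p v ∧ pathWeight (nonnegPart w) p ≤ d) ∧
            ∀ v ∈ H.verts, ∫⁻ ω, etaAt w W H k v ω ∂P ≤ ENNReal.ofReal (C * lg n)) ∨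
        -- or a path of weight more than `d` in `H_{≥ 0}` is found in expected `O(log n)` iterations
          ((∃ v ∈ H.verts, ∀ p, IsShortestPathTo H w p v → d < pathWeight (nonnegPart w) p) ∧
            (∀ ω φ, potentialAt w W ω H k = some φ → FindsLongPath H w φ d) ∧
            ∫⁻ ω, itersAt w W H k ω ∂P ≤ ENNReal.ofReal (C * lg n))) := by
  classical
  refine ⟨12 * (8 * c + 2) + 3, by positivity, ?_⟩
  intro V _ _ E wG W hW _ H k hcyc A h0 hA n w d P
  obtain ⟨ω₀, hω₀⟩ : {ω | IsNode E W ω H k}.Nonempty := nonempty_of_measure_ne_zero h0.ne'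
  have hH : EdgesInVerts H := IsNode.edgesInVerts hω₀
  have hne : H.verts.Nonempty := IsNode.verts_nonempty hω₀
  have hd0 : 0 < d := diam_pos Fintype.card_pos hW k
  have hlg : 1 ≤ lg n := one_le_lg n
  have hP1 : P Set.univ ≤ 1 := prob_le_one
  have hcount : ∀ {p : List V} {v : V}, IsPathTo H p v → pathWeight (nonnegPart w) p ≤ d →
      ∫⁻ ω, (cutCount H k (walkEdges p) ω : ℝ≥0∞) ∂P ≤ ENNReal.ofReal (8 * c * lg n) :=
    fun hp hpd => lintegral_count_cut_le hc hW h0 hA hp.mem_edges hpd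
  by_cases hcase : ∀ v ∈ H.verts, ∃ p, IsShortestPathTo H w p v ∧ pathWeight (nonnegPart w) p ≤ d
  · choose! p hp hpd using hcase
    refine ⟨?_, Or.inl ⟨fun v hv => ⟨p v, hp v hv, hpd v hv⟩, fun v hv => ?_⟩⟩
    · let L : Option V → List (V × V) := fun x =>
        x.elim [] fun v => if v ∈ H.verts then walkEdges (p v) else []
      refine lintegral_timeAt_le hc hW h0 hA hH hne L ?_ ?_ ?_
      · rintro (_ | v) e he
        · exact absurd he List.not_mem_nil
        · simp only [L, Option.elim_some] at he
          split_ifs at he with hv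
          · exact (hp v hv).1.mem_edges e he
          · exact absurd he List.not_mem_nil
      · rintro (_ | v)
        · exact hd0.le
        · simp only [L, Option.elim_some]
          split_ifs with hv
          · exact hpd v hv
          · exact hd0.le
      · rintro ω φ hφ t (_ | v) hx
        · exact (run_iter_le_of_source hH t hx).trans (by omega)
        · have hv : v ∈ H.verts := mem_addSource_verts_some.mp
            ((bfdInv_run (wellFormed_addSource hH) t).marked_mem _ hx)
          refine (run_iter_le_of_shortest hH (potentialAt_spec hH hφ).1 (hp v hv) t hx).trans ?_
          have h1 := negCount_le_cutCount hH hφ (hp v hv).1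
          simp only [L, Option.elim_some, if_pos hv]
          exact Nat.add_le_add h1 one_le_two
    · refine (lintegral_mono (g := fun ω => (cutCount H k (walkEdges (p v)) ω : ℝ≥0∞))
        fun ω => ?_).trans ((hcount (hp v hv).1 (hpd v hv)).trans
          (ENNReal.ofReal_le_ofReal (by gcongr; linarith)))
      unfold etaAt
      split
      · exact zero_le
      · rename_i φ hφ
        have h1 : eta H w φ v ≤ negCount (reweight w φ) (p v) := Nat.sInf_le ⟨p v, hp v hv, rfl⟩
        beta_reduce
        exact_mod_cast h1.trans (negCount_le_cutCount hH hφ (hp v hv).1)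
  · push Not at hcase
    obtain ⟨v, hv, hlong⟩ := hcase
    obtain ⟨p, hp⟩ := hcyc.exists_isShortestPathTo hv
    obtain ⟨q, y, z, hq, hqd, hz, hzlong⟩ := exists_critical_edge hd0.le hp hlong
    have hiter : ∀ ω φ, potentialAt w W ω H k = some φ → ∀ t,
        (run H w φ d t).iter ≤ cutCount H k (walkEdges q) ω + 2 := fun ω φ hφ t =>
      (run_iter_le_of_critical hH (potentialAt_spec hH hφ).1 hq hz hzlong t).1.trans
        (Nat.add_le_add_right (negCount_le_cutCount hH hφ hq) 2)
    refine ⟨lintegral_timeAt_le hc hW h0 hA hH hne (fun _ => walkEdges q)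
      (fun _ => hq.mem_edges) (fun _ => hqd) (fun ω φ hφ t _ _ => hiter ω φ hφ t),
      Or.inr ⟨⟨v, hv, hlong⟩, fun ω φ hφ => findsLongPath_of_critical hH
        (potentialAt_spec hH hφ).1 hd0.le hq hz hzlong, ?_⟩⟩
    refine (lintegral_mono (g := fun ω => (cutCount H k (walkEdges q) ω : ℝ≥0∞) + 2)
      fun ω => ?_).trans ?_
    · unfold itersAt
      split
      · exact zero_le
      · rename_i φ hφ
        refine iSup_le fun t => ?_
        beta_reduce
        exact_mod_cast hiter ω φ hφ t
    · rw [lintegral_add_left Measurable.of_discrete, lintegral_const]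
      refine (add_le_add (hcount hq hqd) (mul_le_of_le_one_right' hP1)).trans ?_
      rw [← ENNReal.ofReal_ofNat 2, ← ENNReal.ofReal_add (by positivity) zero_le_two]
      refine ENNReal.ofReal_le_ofReal ?_
      nlinarith
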